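/- **Setting.** Consider the linear system $x_{t+1}=Ax_t+B_0w_t+B_1\delta_t+B_2u_t$ with $x_t\in\mathbb R^{n_x}$, noise $w_t\in\mathbb R^{n_w}$, adversarial perturbation $\delta_t\in\mathbb R^{n_\delta}$, input $u_t\in\mathbb R^{n_u}$, and performance signal $z_t=\begin{bmatrix}Q^{1/2}\\0\end{bmatrix}x_t+\begin{bmatrix}0\\R^{1/2}\end{bmatrix}u_t$, where $Q\succeq0$, $R\succ0$ and $(A,Q^{1/2})$ is detectable. The initial state $x_0$ is square-integrable with mean zero, the $w_t$ are i.i.d. with mean zero and covariance $I$, and $x_0$ is independent of $(w_t)_{t\ge0}$. A controller is a causal measurable state feedback $u_t=\kappa_t(x_0,\dots,x_t)$. A perturbation $\delta=(\delta_t)$ is causal if each $\delta_t$ is a measurable function of $x_0,w_0,\dots,w_t$ with $\mathbb E\|\delta_t\|^2<\infty$. For $\gamma\in\mathbb R$ the soft-constrained objective of a controller $\kappa$ is $$J_\gamma(\kappa)=\limsup_{T\to\infty}\frac1T\,\sup_{\delta\text{ causal}}\mathbb E\Big[\sum_{t=0}^{T-1}\|z_t\|^2-\gamma^2\|\delta_t\|^2\Big]\in[-\infty,\infty].$$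 Let $\mathcal S_\gamma$ be the set of all $P\succeq0$ with $B_1^\top PB_1\prec\gamma^2I$ that solve the modified DARE $$P=Q+A^\top PA-A^\top PB\,\Psi_P^{-1}B^\top PA,\qquad B=\begin{bmatrix}B_1&B_2\end{bmatrix},\qquad \Psi_P=B^\top PB+\begin{bmatrix}-\gamma^2I&0\\0&R\end{bmatrix}.$$ For $P\in\mathcal S_\gamma$ put $$\begin{bmatrix}E_P\\F_P\end{bmatrix}=-\Psi_P^{-1}B^\top PA,\quad \Delta_P=(\gamma^2I-B_1^\top PB_1)^{-1}B_1^\top PB_0,\quad M_P=P+PB_1(\gamma^2I-B_1^\top PB_1)^{-1}B_1^\top P.$$ **Lemma.** Suppose $\mathcal S_\gamma\neq\emptyset$. Then $\rho(A+B_2F_P)<1$ for every $P\in\mathcal S_\gamma$. Moreover $\mathcal S_\gamma$ has a least element $P_\gamma$ in the positive semidefinite order and, with $E_\gamma,F_\gamma,\Delta_\gamma,M_\gamma$ the corresponding matrices: 1. The static controller $u_t=F_\gamma x_t$ is stabilizing, $\rho(A+B_2F_\gamma)<1$, and minimizes $J_\gamma$ over all controllers. 2. Its objective value is $J_\gamma(F_\gamma)=\operatorname{tr}(M_\gamma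 B_0B_0^\top)$. 3. If in addition $\rho(A+B_1E_\gamma+B_2F_\gamma)<1$, then, under $u_t=F_\gamma x_t$, the perturbation $\delta_t=E_\gamma x_t+\Delta_\gamma w_t$ is causal, it maximizes the long-run average payoff $\limsup_{T\to\infty}\frac1T\mathbb E\big[\sum_{t=0}^{T-1}\|z_t\|^2-\gamma^2\|\delta_t\|^2\big]$ over all causal perturbations, and it attains the value $\operatorname{tr}(M_\gamma B_0B_0^\top)$. -/

import Mathlib

open Matrix MeasureTheory ProbabilityTheory Filter
open scoped MatrixOrder

noncomputable section

/-- Data of the linear system `x₊ = A x + B₀ w + B₁ δ + B₂ u` together with the weights `Q`, `R`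
of the performance signal. -/
structure LQSystem (nx nw nd nu : ℕ) where
  A : Matrix (Fin nx) (Fin nx) ℝ
  B₀ : Matrix (Fin nx) (Fin nw) ℝ
  B₁ : Matrix (Fin nx) (Fin nd) ℝ
  B₂ : Matrix (Fin nx) (Fin nu) ℝ
  Q : Matrix (Fin nx) (Fin nx) ℝ
  R : Matrix (Fin nu) (Fin nu) ℝ

/-- `ρ(M) < 1`; the spectrum of the real matrix `M` is taken over `ℂ`. -/
def IsSchurStable {n : ℕ} (M : Matrix (Fin n) (Fin n) ℝ) : Prop :=
  spectralRadius ℂ (M.map (algebraMap ℝ ℂ)) < 1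

/-- `(A, C)` is detectable: some output injection makes `A + L C` stable. -/
def IsDetectable {n p : ℕ} (A : Matrix (Fin n) (Fin n) ℝ) (C : Matrix (Fin p) (Fin n) ℝ) : Prop :=
  ∃ L : Matrix (Fin n) (Fin p) ℝ, IsSchurStable (A + L * C)

/-- `P` solves the discrete algebraic Riccati equation
`P = Q + Aᵀ P A - Aᵀ P B (Bᵀ P B + R)⁻¹ Bᵀ P A` (with an inverse that exists). -/
def IsDareSolution {n : ℕ} {m : Type} [Fintype m] [DecidableEq m]
    (A : Matrix (Fin n) (Fin n) ℝ) (B : Matrix (Fin n) m ℝ)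
    (Q : Matrix (Fin n) (Fin n) ℝ) (R : Matrix m m ℝ) (P : Matrix (Fin n) (Fin n) ℝ) : Prop :=
  IsUnit (Bᵀ * P * B + R).det ∧
    P = Q + Aᵀ * P * A - Aᵀ * P * B * (Bᵀ * P * B + R)⁻¹ * Bᵀ * P * A

namespace LQSystem

variable {nx nw nd nu : ℕ} (S : LQSystem nx nw nd nu)

/-! ### Dynamics and performance signal -/

/-- `C₁ = [Q^{1/2}; 0]`. -/
def C₁ : Matrix (Fin nx ⊕ Fin nu) (Fin nx) ℝ := fromRows (CFC.sqrt S.Q) 0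

/-- `D₁₂ = [0; R^{1/2}]`. -/
def D₁₂ : Matrix (Fin nx ⊕ Fin nu) (Fin nu) ℝ := fromRows 0 (CFC.sqrt S.R)

/-- A deterministic causal state-feedback law `u_t = κ t (x_0, …, x_t)`. -/
abbrev Controller (nx nu : ℕ) : Type :=
  (t : ℕ) → (Fin (t + 1) → Fin nx → ℝ) → Fin nu → ℝ

/-- The static state feedback `u_t = K x_t`. -/
def staticFeedback (K : Matrix (Fin nu) (Fin nx) ℝ) : Controller nx nu :=
  fun t h => K *ᵥ h (Fin.last t)

/-- The state history `(x_0, …, x_t)` in closed loop with the controller `κ`,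
along a realization of the initial state, of the noise and of the perturbation. -/
def stateHistory (κ : Controller nx nu) (x₀ : Fin nx → ℝ) (w : ℕ → Fin nw → ℝ)
    (δ : ℕ → Fin nd → ℝ) : (t : ℕ) → Fin (t + 1) → Fin nx → ℝ
  | 0 => fun _ => x₀
  | t + 1 =>
    Fin.snoc (α := fun _ => Fin nx → ℝ) (stateHistory κ x₀ w δ t)
      (S.A *ᵥ stateHistory κ x₀ w δ t (Fin.last t) + S.B₀ *ᵥ w t + S.B₁ *ᵥ δ t
        + S.B₂ *ᵥ κ t (stateHistory κ x₀ w δ t))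

/-- The state `x_t`. -/
def state (κ : Controller nx nu) (x₀ : Fin nx → ℝ) (w : ℕ → Fin nw → ℝ)
    (δ : ℕ → Fin nd → ℝ) (t : ℕ) : Fin nx → ℝ :=
  S.stateHistory κ x₀ w δ t (Fin.last t)

/-- The control input `u_t`. -/
def input (κ : Controller nx nu) (x₀ : Fin nx → ℝ) (w : ℕ → Fin nw → ℝ)
    (δ : ℕ → Fin nd → ℝ) (t : ℕ) : Fin nu → ℝ :=
  κ t (S.stateHistory κ x₀ w δ t)

/-- The performance signal `z_t = C₁ x_t + D₁₂ u_t`. -/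
def perf (κ : Controller nx nu) (x₀ : Fin nx → ℝ) (w : ℕ → Fin nw → ℝ)
    (δ : ℕ → Fin nd → ℝ) (t : ℕ) : Fin nx ⊕ Fin nu → ℝ :=
  S.C₁ *ᵥ S.state κ x₀ w δ t + S.D₁₂ *ᵥ S.input κ x₀ w δ t

/-! ### The modified Riccati equation and its gains -/

/-- `[B₁ B₂]`. -/
def B₁₂ : Matrix (Fin nx) (Fin nd ⊕ Fin nu) ℝ := fromCols S.B₁ S.B₂

/-- `diag(-γ² I, R)`. -/
def gameWeight (γ : ℝ) : Matrix (Fin nd ⊕ Fin nu) (Fin nd ⊕ Fin nu) ℝ :=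
  fromBlocks (-(γ ^ 2 • (1 : Matrix (Fin nd) (Fin nd) ℝ))) 0 0 S.R

/-- `P` solves the modified DARE, `P ⪰ 0` and `B₁ᵀ P B₁ ≺ γ² I`. -/
def IsGameSolution (γ : ℝ) (P : Matrix (Fin nx) (Fin nx) ℝ) : Prop :=
  IsDareSolution S.A S.B₁₂ S.Q (S.gameWeight γ) P ∧ P.PosSemidef ∧
    (γ ^ 2 • (1 : Matrix (Fin nd) (Fin nd) ℝ) - S.B₁ᵀ * P * S.B₁).PosDef

/-- `P` is the least, in the positive semidefinite order, among the `P` of `IsGameSolution`. -/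
def IsLeastGameSolution (γ : ℝ) (P : Matrix (Fin nx) (Fin nx) ℝ) : Prop :=
  S.IsGameSolution γ P ∧ ∀ P', S.IsGameSolution γ P' → (P' - P).PosSemidef

/-- `Ψ = [B₁ B₂]ᵀ P [B₁ B₂] + diag(-γ² I, R)`. -/
def Psi (γ : ℝ) (P : Matrix (Fin nx) (Fin nx) ℝ) :
    Matrix (Fin nd ⊕ Fin nu) (Fin nd ⊕ Fin nu) ℝ :=
  S.B₁₂ᵀ * P * S.B₁₂ + S.gameWeight γ

/-- `[E; F] = -Ψ⁻¹ [B₁ B₂]ᵀ P A`. -/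
def gameGain (γ : ℝ) (P : Matrix (Fin nx) (Fin nx) ℝ) :
    Matrix (Fin nd ⊕ Fin nu) (Fin nx) ℝ :=
  -((S.Psi γ P)⁻¹ * S.B₁₂ᵀ * P * S.A)

/-- The adversarial state gain `E`. -/
def gainE (γ : ℝ) (P : Matrix (Fin nx) (Fin nx) ℝ) : Matrix (Fin nd) (Fin nx) ℝ :=
  (S.gameGain γ P).toRows₁

/-- The controller gain `F`. -/
def gainF (γ : ℝ) (P : Matrix (Fin nx) (Fin nx) ℝ) : Matrix (Fin nu) (Fin nx) ℝ :=
  (S.gameGain γ P).toRows₂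

/-- `Δ = (γ² I - B₁ᵀ P B₁)⁻¹ B₁ᵀ P B₀`. -/
def gainDelta (γ : ℝ) (P : Matrix (Fin nx) (Fin nx) ℝ) : Matrix (Fin nd) (Fin nw) ℝ :=
  (γ ^ 2 • (1 : Matrix (Fin nd) (Fin nd) ℝ) - S.B₁ᵀ * P * S.B₁)⁻¹ * S.B₁ᵀ * P * S.B₀

/-- `M = P + P B₁ (γ² I - B₁ᵀ P B₁)⁻¹ B₁ᵀ P`. -/
def gameM (γ : ℝ) (P : Matrix (Fin nx) (Fin nx) ℝ) : Matrix (Fin nx) (Fin nx) ℝ :=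
  P + P * S.B₁ * (γ ^ 2 • (1 : Matrix (Fin nd) (Fin nd) ℝ) - S.B₁ᵀ * P * S.B₁)⁻¹ * S.B₁ᵀ * P

/-! ### Noise, adversary and the soft-constrained objective -/

/-- Zero-mean square-integrable initial state; i.i.d. zero-mean noise with identity covariance,
independent of the initial state. -/
structure IsNoise {Ω : Type*} [MeasurableSpace Ω] (μ : Measure Ω)
    (x₀ : Ω → Fin nx → ℝ) (w : ℕ → Ω → Fin nw → ℝ) : Prop where
  measurable_x₀ : Measurable x₀
  measurable_w : ∀ t, Measurable (w t)
  memLp_x₀ : MemLp x₀ 2 μ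
  memLp_w : ∀ t, MemLp (w t) 2 μ
  mean_x₀ : ∀ i, ∫ ω, x₀ ω i ∂μ = 0
  mean_w : ∀ t i, ∫ ω, w t ω i ∂μ = 0
  cov_w : ∀ t i j, ∫ ω, w t ω i * w t ω j ∂μ = (1 : Matrix (Fin nw) (Fin nw) ℝ) i j
  identDistrib_w : ∀ t, IdentDistrib (w t) (w 0) μ μ
  iIndepFun_w : iIndepFun w μ
  indepFun_x₀_w : IndepFun x₀ (fun ω t => w t ω) μ

/-- Causal perturbations: `δ_t` is a measurable function of `x_0, w_0, …, w_t`.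
Finite second moments make the penalty finite. -/
def IsCausalAdversary {Ω : Type*} [MeasurableSpace Ω] (μ : Measure Ω)
    (x₀ : Ω → Fin nx → ℝ) (w : ℕ → Ω → Fin nw → ℝ) (δ : ℕ → Ω → Fin nd → ℝ) : Prop :=
  ∀ t, Measurable[MeasurableSpace.comap
      (fun ω => (x₀ ω, fun s : Fin (t + 1) => w s ω)) inferInstance] (δ t) ∧
    MemLp (δ t) 2 μ

/-- `E [∑_{t<T} ‖z_t‖² - γ² ‖δ_t‖²]`, where the penalty has finite expectation for causal
adversaries and the first part may be `+∞`. -/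
def expectedPayoff {Ω : Type*} [MeasurableSpace Ω] (μ : Measure Ω)
    (x₀ : Ω → Fin nx → ℝ) (w : ℕ → Ω → Fin nw → ℝ) (γ : ℝ) (κ : Controller nx nu)
    (δ : ℕ → Ω → Fin nd → ℝ) (T : ℕ) : EReal :=
  ((∫⁻ ω, ENNReal.ofReal (∑ t ∈ Finset.range T,
      S.perf κ (x₀ ω) (fun s => w s ω) (fun s => δ s ω) t ⬝ᵥ
        S.perf κ (x₀ ω) (fun s => w s ω) (fun s => δ s ω) t) ∂μ : ENNReal) : EReal)
    - ((∫⁻ ω, ENNReal.ofReal (γ ^ 2 * ∑ t ∈ Finset.range T, δ t ω ⬝ᵥ δ t ω) ∂μ : ENNReal) : EReal)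

/-- Long-run average payoff of a fixed perturbation process. -/
def averagePayoff {Ω : Type*} [MeasurableSpace Ω] (μ : Measure Ω)
    (x₀ : Ω → Fin nx → ℝ) (w : ℕ → Ω → Fin nw → ℝ) (γ : ℝ) (κ : Controller nx nu)
    (δ : ℕ → Ω → Fin nd → ℝ) : EReal :=
  limsup (fun T : ℕ => (((T : ℝ)⁻¹ : ℝ) : EReal) * S.expectedPayoff μ x₀ w γ κ δ T) atTop

/-- The soft-constrained objective
`limsup_T (1/T) sup_{δ causal} E [∑_{t<T} ‖z_t‖² - γ² ‖δ_t‖²]`. -/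
def softObjective {Ω : Type*} [MeasurableSpace Ω] (μ : Measure Ω)
    (x₀ : Ω → Fin nx → ℝ) (w : ℕ → Ω → Fin nw → ℝ) (γ : ℝ) (κ : Controller nx nu) : EReal :=
  limsup (fun T : ℕ => (((T : ℝ)⁻¹ : ℝ) : EReal) *
    ⨆ (δ : ℕ → Ω → Fin nd → ℝ) (_ : IsCausalAdversary μ x₀ w δ),
      S.expectedPayoff μ x₀ w γ κ δ T) atTop

end LQSystem

end

noncomputable section

/-! ### Quadratic forms -/

section QuadForm

/-! Fix a quadratic continuation value P with γ²I − B₁ᵀPB₁ ≻ 0. One stage of the game is solved by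
two completions of the square. The adversary moves last and sees the unperturbed successor y = Ax +
B₂u + B₀w; maximizing over δ replaces P by M_P, with a remainder weighted by `advWeight`
(`quadForm_add_perturbation`). The noise in y is independent of the past and contributes the
constant tr(M_P B₀B₀ᵀ). Minimizing over u then replaces M_P by `riccati γ P`, with a remainder
weighted by `inputWeight` (`quadForm_add_input`). Taking expectations gives `integral_step`, and
telescoping gives `sum_stagePayoff`.

Block elimination identifies the modified DARE and its side conditions with the fixed-point equation
`riccati γ P = P` on admissible matrices (`isGameSolution_iff`). As a minimum of a maximum,
`riccati` is monotone. Value iteration from 0 therefore increases and stays below every solution,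
and its limit is the least one.

The telescoped identity yields both bounds on the value. For any solution P, the constant sequence P
and the input u = F_P x leave no input remainder, so every causal perturbation earns at most
E[x₀ᵀPx₀] + T tr(M_P B₀B₀ᵀ). Conversely, against any controller the adversary that is optimal for
the horizon T secures the sum of the traces along the first T value iterates, and the Cesàro mean of
these tends to the trace at the least solution. At the least solution the two bounds meet.

Against u = F_γ x, the perturbation E_γ x + Δ_γ w makes the adversarial remainder vanish. Its
average payoff is then optimal as soon as the terminal term E[x_Tᵀ P x_T] stays bounded, which is
where stability of A + B₁E_γ + B₂F_γ enters. Stability of A + B₂F_P comes from a Lyapunov argument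
with P itself and detectability. -/

lemma Matrix.PosSemidef.transpose_eq {n : Type*} {P : Matrix n n ℝ} (hP : P.PosSemidef) :
    Pᵀ = P := by
  simpa [Matrix.IsHermitian] using hP.isHermitian

lemma Matrix.PosDef.transpose_eq {n : Type*} {P : Matrix n n ℝ} (hP : P.PosDef) : Pᵀ = P :=
  hP.posSemidef.transpose_eq

variable {m n : Type*} [Fintype m] [Fintype n]

/-- The quadratic form `xᵀ P x`. -/
def quadForm (P : Matrix n n ℝ) (x : n → ℝ) : ℝ := x ⬝ᵥ P *ᵥ x

lemma Matrix.PosDef.isUnit_det_real [DecidableEq n] {P : Matrix n n ℝ} (hP : P.PosDef) :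
    IsUnit P.det :=
  (Matrix.isUnit_iff_isUnit_det _).1 hP.isUnit

lemma Matrix.PosSemidef.quadForm_nonneg {P : Matrix n n ℝ} (hP : P.PosSemidef) (x : n → ℝ) :
    0 ≤ quadForm P x := by
  simpa [quadForm] using hP.dotProduct_mulVec_nonneg x

lemma Matrix.PosDef.eq_zero_of_quadForm_eq_zero {P : Matrix n n ℝ} (hP : P.PosDef) {x : n → ℝ}
    (h : quadForm P x = 0) : x = 0 := by
  by_contra hx
  have := hP.dotProduct_mulVec_pos hx
  simp only [star_trivial] at this
  exact this.ne' h

lemma posSemidef_of_quadForm_nonneg {P : Matrix n n ℝ} (h : Pᵀ = P)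
    (h' : ∀ x, 0 ≤ quadForm P x) : P.PosSemidef :=
  .of_dotProduct_mulVec_nonneg (by simpa [Matrix.IsHermitian] using h)
    (by simpa [quadForm] using h')

lemma dotProduct_mulVec_transpose (N : Matrix m n ℝ) (y : m → ℝ) (x : n → ℝ) :
    y ⬝ᵥ N *ᵥ x = (Nᵀ *ᵥ y) ⬝ᵥ x := by
  rw [dotProduct_mulVec, mulVec_transpose]

lemma dotProduct_mulVec_comm {P : Matrix n n ℝ} (hP : Pᵀ = P) (x y : n → ℝ) :
    x ⬝ᵥ P *ᵥ y = y ⬝ᵥ P *ᵥ x := by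
  rw [dotProduct_mulVec_transpose, hP, dotProduct_comm]

lemma quadForm_add {P : Matrix n n ℝ} (hP : Pᵀ = P) (x y : n → ℝ) :
    quadForm P (x + y) = quadForm P x + 2 * (y ⬝ᵥ P *ᵥ x) + quadForm P y := by
  simp only [quadForm, mulVec_add, dotProduct_add, add_dotProduct]
  rw [dotProduct_mulVec_comm hP x y]
  ring

lemma quadForm_sub {P : Matrix n n ℝ} (hP : Pᵀ = P) (x y : n → ℝ) :
    quadForm P (x - y) = quadForm P x - 2 * (x ⬝ᵥ P *ᵥ y) + quadForm P y := by
  simp only [quadForm, mulVec_sub, dotProduct_sub, sub_dotProduct]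
  rw [dotProduct_mulVec_comm hP y x]
  ring

lemma quadForm_smul (P : Matrix n n ℝ) (c : ℝ) (x : n → ℝ) :
    quadForm P (c • x) = c ^ 2 * quadForm P x := by
  simp only [quadForm, mulVec_smul, dotProduct_smul, smul_dotProduct, smul_eq_mul]
  ring

lemma quadForm_mulVec (P : Matrix m m ℝ) (N : Matrix m n ℝ) (x : n → ℝ) :
    quadForm P (N *ᵥ x) = quadForm (Nᵀ * P * N) x := by
  simp only [quadForm, ← mulVec_mulVec]
  rw [dotProduct_mulVec_transpose Nᵀ, transpose_transpose]

lemma quadForm_matrix_add (P P' : Matrix n n ℝ) (x : n → ℝ) :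
    quadForm (P + P') x = quadForm P x + quadForm P' x := by
  simp [quadForm, add_mulVec]

lemma quadForm_matrix_sub (P P' : Matrix n n ℝ) (x : n → ℝ) :
    quadForm (P - P') x = quadForm P x - quadForm P' x := by
  simp [quadForm, sub_mulVec]

lemma quadForm_one [DecidableEq n] (x : n → ℝ) :
    quadForm (1 : Matrix n n ℝ) x = x ⬝ᵥ x := by
  simp [quadForm]

lemma quadForm_zero (P : Matrix n n ℝ) : quadForm P 0 = 0 := by
  simp [quadForm]

/-- Completing the square. -/
lemma quadForm_sub_inv_mulVec [DecidableEq n] {H : Matrix n n ℝ} (hH : H.PosDef)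
    (v b : n → ℝ) :
    quadForm H (v - H⁻¹ *ᵥ b) = quadForm H v - 2 * (v ⬝ᵥ b) + quadForm H⁻¹ b := by
  rw [quadForm_sub hH.transpose_eq]
  have h : H *ᵥ H⁻¹ *ᵥ b = b := by
    rw [mulVec_mulVec, Matrix.mul_nonsing_inv _ hH.isUnit_det_real, one_mulVec]
  simp only [quadForm, h]
  rw [dotProduct_comm (H⁻¹ *ᵥ b)]

end QuadForm

namespace LQSystem

variable {nx nw nd nu : ℕ} (S : LQSystem nx nw nd nu)

/-! ### The Riccati operator of the soft-constrained game -/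

/-- `γ² I - B₁ᵀ P B₁`. -/
def advWeight (γ : ℝ) (P : Matrix (Fin nx) (Fin nx) ℝ) : Matrix (Fin nd) (Fin nd) ℝ :=
  γ ^ 2 • (1 : Matrix (Fin nd) (Fin nd) ℝ) - S.B₁ᵀ * P * S.B₁

/-- The maximizing perturbation as a linear function of the unperturbed successor state. -/
def advGain (γ : ℝ) (P : Matrix (Fin nx) (Fin nx) ℝ) : Matrix (Fin nd) (Fin nx) ℝ :=
  (S.advWeight γ P)⁻¹ * (S.B₁ᵀ * P)

/-- `R + B₂ᵀ M B₂`. -/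
def inputWeight (γ : ℝ) (P : Matrix (Fin nx) (Fin nx) ℝ) : Matrix (Fin nu) (Fin nu) ℝ :=
  S.R + S.B₂ᵀ * S.gameM γ P * S.B₂

/-- The minimizing feedback gain. -/
def inputGain (γ : ℝ) (P : Matrix (Fin nx) (Fin nx) ℝ) : Matrix (Fin nu) (Fin nx) ℝ :=
  -((S.inputWeight γ P)⁻¹ * (S.B₂ᵀ * S.gameM γ P * S.A))

/-- One step of the value iteration of the soft-constrained game. -/
def riccati (γ : ℝ) (P : Matrix (Fin nx) (Fin nx) ℝ) : Matrix (Fin nx) (Fin nx) ℝ :=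
  S.Q + S.Aᵀ * S.gameM γ P * S.A
    - (S.B₂ᵀ * S.gameM γ P * S.A)ᵀ * (S.inputWeight γ P)⁻¹ * (S.B₂ᵀ * S.gameM γ P * S.A)

/-- The set on which the maximization over the perturbation is strictly concave. -/
def IsAdmissible (γ : ℝ) (P : Matrix (Fin nx) (Fin nx) ℝ) : Prop :=
  P.PosSemidef ∧ (S.advWeight γ P).PosDef

variable {S} {γ : ℝ} {P P' : Matrix (Fin nx) (Fin nx) ℝ}

lemma gameM_eq (hP : P.PosSemidef) :
    S.gameM γ P = P + (S.B₁ᵀ * P)ᵀ * (S.advWeight γ P)⁻¹ * (S.B₁ᵀ * P) := by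
  simp only [gameM, advWeight, transpose_mul, transpose_transpose, hP.transpose_eq,
    Matrix.mul_assoc]

lemma quadForm_gameM (hP : P.PosSemidef) (y : Fin nx → ℝ) :
    quadForm (S.gameM γ P) y
      = quadForm P y + quadForm (S.advWeight γ P)⁻¹ ((S.B₁ᵀ * P) *ᵥ y) := by
  rw [gameM_eq hP, quadForm_matrix_add, quadForm_mulVec]

namespace IsAdmissible

lemma gameM_posSemidef (h : S.IsAdmissible γ P) : (S.gameM γ P).PosSemidef := by
  rw [gameM_eq h.1]
  refine h.1.add ?_
  simpa using h.2.inv.posSemidef.conjTranspose_mul_mul_same (S.B₁ᵀ * P)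

/-- Playing no perturbation is one option in the maximization that defines M. -/
lemma quadForm_le_gameM (h : S.IsAdmissible γ P) (y : Fin nx → ℝ) :
    quadForm P y ≤ quadForm (S.gameM γ P) y := by
  rw [quadForm_gameM h.1]
  linarith [h.2.inv.posSemidef.quadForm_nonneg ((S.B₁ᵀ * P) *ᵥ y)]

lemma inputWeight_posDef (h : S.IsAdmissible γ P) (hR : S.R.PosDef) :
    (S.inputWeight γ P).PosDef := by
  refine hR.add_posSemidef ?_
  simpa using h.gameM_posSemidef.conjTranspose_mul_mul_same S.B₂

/-- The inner maximization over the perturbation. -/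
lemma quadForm_add_perturbation (h : S.IsAdmissible γ P) (y : Fin nx → ℝ) (d : Fin nd → ℝ) :
    quadForm P (y + S.B₁ *ᵥ d) - γ ^ 2 * (d ⬝ᵥ d)
      = quadForm (S.gameM γ P) y - quadForm (S.advWeight γ P) (d - S.advGain γ P *ᵥ y) := by
  have h1 : S.advGain γ P *ᵥ y = (S.advWeight γ P)⁻¹ *ᵥ ((S.B₁ᵀ * P) *ᵥ y) := by
    rw [advGain, mulVec_mulVec]
  rw [h1, quadForm_sub_inv_mulVec h.2, quadForm_gameM h.1, quadForm_add h.1.transpose_eq,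
    quadForm_mulVec]
  have h2 : quadForm (S.advWeight γ P) d
      = γ ^ 2 * (d ⬝ᵥ d) - quadForm (S.B₁ᵀ * P * S.B₁) d := by
    rw [advWeight, quadForm_matrix_sub]
    simp [quadForm, smul_mulVec]
  have h3 : S.B₁ *ᵥ d ⬝ᵥ P *ᵥ y = d ⬝ᵥ (S.B₁ᵀ * P) *ᵥ y := by
    rw [← mulVec_mulVec, dotProduct_mulVec_transpose S.B₁ᵀ, transpose_transpose]
  rw [h2, h3]
  ring

/-- The outer minimization over the input. -/
lemma quadForm_add_input (h : S.IsAdmissible γ P) (hR : S.R.PosDef) (x : Fin nx → ℝ)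
    (u : Fin nu → ℝ) :
    quadForm S.Q x + quadForm S.R u + quadForm (S.gameM γ P) (S.A *ᵥ x + S.B₂ *ᵥ u)
      = quadForm (S.riccati γ P) x
        + quadForm (S.inputWeight γ P) (u - S.inputGain γ P *ᵥ x) := by
  have hM := h.gameM_posSemidef.transpose_eq
  have h1 : S.inputGain γ P *ᵥ x
      = (S.inputWeight γ P)⁻¹ *ᵥ -((S.B₂ᵀ * S.gameM γ P * S.A) *ᵥ x) := by
    rw [inputGain, neg_mulVec, ← mulVec_mulVec, mulVec_neg]
  have h2 : quadForm (S.inputWeight γ P)⁻¹ (-((S.B₂ᵀ * S.gameM γ P * S.A) *ᵥ x))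
      = quadForm ((S.B₂ᵀ * S.gameM γ P * S.A)ᵀ * (S.inputWeight γ P)⁻¹
          * (S.B₂ᵀ * S.gameM γ P * S.A)) x := by
    rw [← quadForm_mulVec]
    simp [quadForm, mulVec_neg]
  have h3 : S.B₂ *ᵥ u ⬝ᵥ S.gameM γ P *ᵥ S.A *ᵥ x
      = u ⬝ᵥ (S.B₂ᵀ * S.gameM γ P * S.A) *ᵥ x := by
    rw [← mulVec_mulVec, ← mulVec_mulVec, dotProduct_mulVec_transpose S.B₂ᵀ,
      transpose_transpose]
  have h4 : quadForm (S.inputWeight γ P) u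
      = quadForm S.R u + quadForm (S.B₂ᵀ * S.gameM γ P * S.B₂) u := by
    rw [inputWeight, quadForm_matrix_add]
  rw [h1, quadForm_sub_inv_mulVec (h.inputWeight_posDef hR), h2, quadForm_add hM, h3, riccati,
    quadForm_matrix_sub, quadForm_matrix_add, quadForm_mulVec, quadForm_mulVec, h4,
    dotProduct_neg]
  ring

lemma riccati_transpose (h : S.IsAdmissible γ P) (hQ : S.Q.PosSemidef) (hR : S.R.PosDef) :
    (S.riccati γ P)ᵀ = S.riccati γ P := by
  simp only [riccati, transpose_sub, transpose_add, transpose_mul, transpose_transpose,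
    hQ.transpose_eq, h.gameM_posSemidef.transpose_eq,
    (h.inputWeight_posDef hR).inv.transpose_eq, Matrix.mul_assoc]

/-- At the minimizing input the remainder vanishes and the value is a sum of three nonnegative
costs. -/
lemma riccati_posSemidef (h : S.IsAdmissible γ P) (hQ : S.Q.PosSemidef) (hR : S.R.PosDef) :
    (S.riccati γ P).PosSemidef := by
  refine posSemidef_of_quadForm_nonneg (h.riccati_transpose hQ hR) fun x => ?_
  have e := h.quadForm_add_input hR x (S.inputGain γ P *ᵥ x)
  rw [sub_self, quadForm_zero, add_zero] at e
  rw [← e]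
  have := hQ.quadForm_nonneg x
  have := hR.posSemidef.quadForm_nonneg (S.inputGain γ P *ᵥ x)
  have := h.gameM_posSemidef.quadForm_nonneg (S.A *ᵥ x + S.B₂ *ᵥ S.inputGain γ P *ᵥ x)
  linarith

/-- Lowering P adds the semidefinite matrix B₁ᵀ(P' − P)B₁ to the adversary's weight, so strict
concavity is inherited downwards. This keeps all value iterates, and their limit, in the domain of
`riccati`. -/
lemma mono (h : S.IsAdmissible γ P') (hP : P.PosSemidef)
    (hle : (P' - P).PosSemidef) : S.IsAdmissible γ P := by
  refine ⟨hP, ?_⟩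
  have e : S.advWeight γ P = S.advWeight γ P' + S.B₁ᵀ * (P' - P) * S.B₁ := by
    simp only [advWeight, Matrix.mul_sub, Matrix.sub_mul]
    abel
  rw [e]
  refine h.2.add_posSemidef ?_
  simpa using hle.conjTranspose_mul_mul_same S.B₁

/-- A maximum is monotone in its objective: the perturbation optimal for P is merely feasible for
P', and it already earns at least as much there. -/
lemma gameM_mono (h : S.IsAdmissible γ P) (h' : S.IsAdmissible γ P')
    (hle : (P' - P).PosSemidef) (y : Fin nx → ℝ) :
    quadForm (S.gameM γ P) y ≤ quadForm (S.gameM γ P') y := by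
  have e := h.quadForm_add_perturbation y (S.advGain γ P *ᵥ y)
  have e' := h'.quadForm_add_perturbation y (S.advGain γ P *ᵥ y)
  rw [sub_self, quadForm_zero] at e
  have h1 := h'.2.posSemidef.quadForm_nonneg (S.advGain γ P *ᵥ y - S.advGain γ P' *ᵥ y)
  have h2 := hle.quadForm_nonneg (y + S.B₁ *ᵥ S.advGain γ P *ᵥ y)
  rw [quadForm_matrix_sub] at h2
  linarith

/-- A minimum is monotone in its objective: use the input optimal for P' as a feasible input for P,
then apply `gameM_mono`. -/
lemma riccati_mono (h : S.IsAdmissible γ P) (h' : S.IsAdmissible γ P') (hQ : S.Q.PosSemidef)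
    (hR : S.R.PosDef) (hle : (P' - P).PosSemidef) :
    (S.riccati γ P' - S.riccati γ P).PosSemidef := by
  refine posSemidef_of_quadForm_nonneg ?_ fun x => ?_
  · rw [transpose_sub, h.riccati_transpose hQ hR, h'.riccati_transpose hQ hR]
  · rw [quadForm_matrix_sub]
    have e := h.quadForm_add_input hR x (S.inputGain γ P' *ᵥ x)
    have e' := h'.quadForm_add_input hR x (S.inputGain γ P' *ᵥ x)
    rw [sub_self, quadForm_zero] at e'
    have h1 := (h.inputWeight_posDef hR).posSemidef.quadForm_nonneg
      (S.inputGain γ P' *ᵥ x - S.inputGain γ P *ᵥ x)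
    have h2 := h.gameM_mono h' hle (S.A *ᵥ x + S.B₂ *ᵥ S.inputGain γ P' *ᵥ x)
    linarith

/-! ### The modified Riccati equation in Schur complement form -/

end IsAdmissible

lemma Psi_eq : S.Psi γ P = fromBlocks (-S.advWeight γ P) (S.B₁ᵀ * P * S.B₂)
    (S.B₂ᵀ * P * S.B₁) (S.R + S.B₂ᵀ * P * S.B₂) := by
  rw [Psi, B₁₂, gameWeight, transpose_fromCols, fromRows_mul, fromRows_mul_fromCols,
    fromBlocks_add, advWeight]
  congr 1
  · abel
  · simp
  · simp
  · abel

namespace IsAdmissible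

/-- The block −`advWeight` is invertible, and its Schur complement in Ψ is exactly R + B₂ᵀMB₂, which
is positive definite. -/
lemma isUnit_Psi_det (h : S.IsAdmissible γ P) (hR : S.R.PosDef) : IsUnit (S.Psi γ P).det := by
  have hW := h.2.isUnit_det_real
  have hn : IsUnit (-S.advWeight γ P).det := by
    rw [det_neg]
    exact (IsUnit.pow _ (by simp)).mul hW
  let := Matrix.invertibleOfIsUnitDet _ hn
  rw [Psi_eq, det_fromBlocks₁₁]
  refine hn.mul ?_
  convert (h.inputWeight_posDef hR).isUnit_det_real using 2
  have hi : (⅟(-S.advWeight γ P)) = -(S.advWeight γ P)⁻¹ := by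
    refine invOf_eq_right_inv ?_
    rw [neg_mul_neg, Matrix.mul_nonsing_inv _ hW]
  rw [hi, inputWeight, gameM, ← advWeight]
  simp only [Matrix.mul_add, Matrix.add_mul, Matrix.mul_neg, Matrix.neg_mul, sub_neg_eq_add,
    Matrix.mul_assoc, add_assoc]

lemma inputWeight_mul_inputGain (h : S.IsAdmissible γ P) (hR : S.R.PosDef) :
    S.inputWeight γ P * S.inputGain γ P = -(S.B₂ᵀ * S.gameM γ P * S.A) := by
  rw [inputGain, Matrix.mul_neg, ← Matrix.mul_assoc,
    Matrix.mul_nonsing_inv _ (h.inputWeight_posDef hR).isUnit_det_real, Matrix.one_mul]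

lemma gameM_mul (h : S.IsAdmissible γ P) {k : Type*} [Fintype k] (X : Matrix (Fin nx) k ℝ) :
    S.gameM γ P * X = P * X + P * S.B₁ * (S.advGain γ P * X) := by
  simp only [gameM_eq h.1, advGain, transpose_mul, transpose_transpose, h.1.transpose_eq,
    Matrix.add_mul, Matrix.mul_assoc]

/-- Block elimination in Ψ[E; F] = −BᵀPA: the first row gives E as the adversary's reaction to the
successor (A + B₂F)x, and substituting it into the second row turns P into M. The proof checks that
these gains solve the system and cancels Ψ. -/
lemma gameGain_eq (h : S.IsAdmissible γ P) (hR : S.R.PosDef) :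
    S.gameGain γ P = fromRows (S.advGain γ P * (S.A + S.B₂ * S.inputGain γ P))
      (S.inputGain γ P) := by
  have hu := h.isUnit_Psi_det hR
  have hW := h.2.isUnit_det_real
  have e := h.inputWeight_mul_inputGain hR
  set F := S.inputGain γ P with hF
  set X := S.A + S.B₂ * F with hX
  have hmul : S.Psi γ P * fromRows (S.advGain γ P * X) F = -(S.B₁₂ᵀ * P * S.A) := by
    rw [Psi_eq, fromBlocks_mul_fromRows, B₁₂, transpose_fromCols, fromRows_mul, fromRows_mul]
    have r1 : S.advWeight γ P * (S.advGain γ P * X) = S.B₁ᵀ * P * X := by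
      rw [advGain, ← Matrix.mul_assoc, ← Matrix.mul_assoc, Matrix.mul_nonsing_inv _ hW,
        Matrix.one_mul]
    have r2 : S.R * F = -(S.B₂ᵀ * (S.gameM γ P * X)) := by
      rw [inputWeight, Matrix.add_mul] at e
      rw [hX, Matrix.mul_add, Matrix.mul_add]
      simp only [Matrix.mul_assoc] at e ⊢
      rw [eq_sub_of_add_eq e]
      abel
    have c1 : -S.advWeight γ P * (S.advGain γ P * X) + S.B₁ᵀ * P * S.B₂ * F
        = -(S.B₁ᵀ * P * S.A) := by
      rw [Matrix.neg_mul, r1, hX]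
      simp only [Matrix.mul_add, Matrix.mul_assoc]
      abel
    have c2 : S.B₂ᵀ * P * S.B₁ * (S.advGain γ P * X) + (S.R + S.B₂ᵀ * P * S.B₂) * F
        = -(S.B₂ᵀ * P * S.A) := by
      rw [Matrix.add_mul, r2, h.gameM_mul, hX]
      simp only [Matrix.mul_add, Matrix.mul_assoc]
      abel
    rw [c1, c2]
    ext (i | i) j <;> simp
  have : S.gameGain γ P = (S.Psi γ P)⁻¹ * (S.Psi γ P * fromRows (S.advGain γ P * X) F) := by
    rw [hmul, gameGain, Matrix.mul_neg]
    simp only [Matrix.mul_assoc]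
  rw [this, ← Matrix.mul_assoc, Matrix.nonsing_inv_mul _ hu, Matrix.one_mul]

lemma gainF_eq (h : S.IsAdmissible γ P) (hR : S.R.PosDef) :
    S.gainF γ P = S.inputGain γ P := by
  rw [gainF, h.gameGain_eq hR, toRows₂_fromRows]

lemma gainE_eq (h : S.IsAdmissible γ P) (hR : S.R.PosDef) :
    S.gainE γ P = S.advGain γ P * (S.A + S.B₂ * S.inputGain γ P) := by
  rw [gainE, h.gameGain_eq hR, toRows₁_fromRows]

/-- Both sides equal Q + AᵀM(A + B₂F), because M X = P X + PB₁(`advGain` X) with X = A + B₂F and E =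
`advGain` X. -/
lemma dare_eq_riccati (h : S.IsAdmissible γ P) (hR : S.R.PosDef) :
    S.Q + S.Aᵀ * P * S.A - S.Aᵀ * P * S.B₁₂ * (S.B₁₂ᵀ * P * S.B₁₂ + S.gameWeight γ)⁻¹
      * S.B₁₂ᵀ * P * S.A = S.riccati γ P := by
  have e : S.Aᵀ * P * S.B₁₂ * (S.B₁₂ᵀ * P * S.B₁₂ + S.gameWeight γ)⁻¹ * S.B₁₂ᵀ * P * S.A
      = -(S.Aᵀ * P * (S.B₁₂ * S.gameGain γ P)) := by
    rw [gameGain, Psi]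
    simp only [Matrix.mul_neg, neg_neg, Matrix.mul_assoc]
  have er : S.riccati γ P = S.Q + S.Aᵀ * (S.gameM γ P * (S.A + S.B₂ * S.inputGain γ P)) := by
    rw [riccati, inputGain]
    simp only [transpose_mul, transpose_transpose, h.gameM_posSemidef.transpose_eq,
      Matrix.mul_add, Matrix.mul_neg, Matrix.mul_assoc]
    abel
  rw [e, er, h.gameM_mul, h.gameGain_eq hR, B₁₂, fromCols_mul_fromRows]
  simp only [Matrix.mul_add, Matrix.mul_assoc]
  abel

end IsAdmissible

lemma isGameSolution_iff (hR : S.R.PosDef) :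
    S.IsGameSolution γ P ↔ S.IsAdmissible γ P ∧ S.riccati γ P = P := by
  constructor
  · rintro ⟨⟨_, h2⟩, h3, h4⟩
    have h : S.IsAdmissible γ P := ⟨h3, h4⟩
    exact ⟨h, (h.dare_eq_riccati hR).symm.trans h2.symm⟩
  · rintro ⟨h, h2⟩
    exact ⟨⟨h.isUnit_Psi_det hR, h2.symm.trans (h.dare_eq_riccati hR).symm⟩, h.1, h.2⟩

end LQSystem

/-! ### Schur stability -/

section Stability

open scoped Topology

variable {n : ℕ} {M : Matrix (Fin n) (Fin n) ℝ}

lemma isSchurStable_of_forall_spectrum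
    (h : ∀ z ∈ spectrum ℂ (M.map (algebraMap ℝ ℂ)), ‖z‖ < 1) : IsSchurStable M := by
  let _ := Matrix.linftyOpNormedRing (n := Fin n) (α := ℂ)
  let _ := Matrix.linftyOpNormedAlgebra (n := Fin n) (R := ℂ) (α := ℂ)
  -- The spectrum is empty when n = 0; the supremum defining the spectral radius is then 0.
  rcases (spectrum ℂ (M.map (algebraMap ℝ ℂ))).eq_empty_or_nonempty with he | hne
  · rw [IsSchurStable, spectralRadius, he]
    simp
  · have := spectrum.spectralRadius_lt_of_forall_lt_of_nonempty (r := 1) hne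
      fun z hz => by simpa [← NNReal.coe_lt_coe] using h z hz
    simpa [IsSchurStable] using this

lemma IsSchurStable.norm_lt_one (h : IsSchurStable M) {z : ℂ}
    (hz : z ∈ spectrum ℂ (M.map (algebraMap ℝ ℂ))) : ‖z‖ < 1 := by
  have h1 : (‖z‖₊ : ENNReal) ≤ spectralRadius ℂ (M.map (algebraMap ℝ ℂ)) :=
    le_iSup₂ (f := fun (k : ℂ) (_ : k ∈ spectrum ℂ (M.map (algebraMap ℝ ℂ))) =>
      (‖k‖₊ : ENNReal)) z hz
  have h2 := h1.trans_lt h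
  rw [← ENNReal.coe_one, ENNReal.coe_lt_coe] at h2
  exact_mod_cast h2

lemma mem_spectrum_iff_exists_mulVec {N : Matrix (Fin n) (Fin n) ℂ} {z : ℂ} :
    z ∈ spectrum ℂ N ↔ ∃ v, v ≠ 0 ∧ N *ᵥ v = z • v := by
  rw [spectrum.mem_iff, Matrix.isUnit_iff_isUnit_det, isUnit_iff_ne_zero, not_not,
    ← Matrix.exists_mulVec_eq_zero_iff]
  refine exists_congr fun v => and_congr_right fun _ => ?_
  rw [sub_mulVec, sub_eq_zero, Algebra.algebraMap_eq_smul_one, smul_mulVec, one_mulVec, eq_comm]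

/-- Eigenvectors of a real matrix, split into real and imaginary parts. -/
lemma map_mulVec_eq_smul_iff {z : ℂ} {v : Fin n → ℂ} :
    M.map (algebraMap ℝ ℂ) *ᵥ v = z • v ↔
      (M *ᵥ (fun i => (v i).re) = z.re • (fun i => (v i).re) - z.im • fun i => (v i).im) ∧
      (M *ᵥ (fun i => (v i).im) = z.im • (fun i => (v i).re) + z.re • fun i => (v i).im) := by
  simp only [funext_iff, ← forall_and]
  refine forall_congr' fun i => ?_
  rw [Complex.ext_iff]
  simp [mulVec, dotProduct, add_comm]

/-- An eigenvector a + ib with eigenvalue c + id, written over ℝ so that real quadratic forms can be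
applied to it. -/
lemma IsSchurStable.sq_add_sq_lt_one (h : IsSchurStable M) {a b : Fin n → ℝ} {c d : ℝ}
    (ha : M *ᵥ a = c • a - d • b) (hb : M *ᵥ b = d • a + c • b) (hab : a ≠ 0 ∨ b ≠ 0) :
    c ^ 2 + d ^ 2 < 1 := by
  have hz : (⟨c, d⟩ : ℂ) ∈ spectrum ℂ (M.map (algebraMap ℝ ℂ)) := by
    refine mem_spectrum_iff_exists_mulVec.2 ⟨fun i => ⟨a i, b i⟩, ?_, ?_⟩
    · intro h0
      rcases hab with h' | h' <;> apply h' <;> funext i <;> have := congrFun h0 i <;>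
        simp [Complex.ext_iff] at this <;> simp [this]
    · exact map_mulVec_eq_smul_iff.2 ⟨ha, hb⟩
  have h1 := h.norm_lt_one hz
  rw [← sq_lt_one_iff₀ (norm_nonneg _), Complex.sq_norm, Complex.normSq_mk] at h1
  linarith

lemma isSchurStable_of_forall
    (h : ∀ (a b : Fin n → ℝ) (c d : ℝ), M *ᵥ a = c • a - d • b → M *ᵥ b = d • a + c • b →
      (a ≠ 0 ∨ b ≠ 0) → c ^ 2 + d ^ 2 < 1) : IsSchurStable M := by
  refine isSchurStable_of_forall_spectrum fun z hz => ?_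
  obtain ⟨v, hv, hvz⟩ := mem_spectrum_iff_exists_mulVec.1 hz
  obtain ⟨h1, h2⟩ := map_mulVec_eq_smul_iff.1 hvz
  rw [← sq_lt_one_iff₀ (norm_nonneg _), Complex.sq_norm, Complex.normSq_apply]
  have := h _ _ _ _ h1 h2 ?_
  · linarith
  · by_contra! h0
    apply hv
    funext i
    exact Complex.ext (congrFun h0.1 i) (congrFun h0.2 i)

/-- A semidefinite Lyapunov inequality certifies stability, given detectability. -/
lemma IsDetectable.isSchurStable_of_lyapunov {p : ℕ} {A : Matrix (Fin n) (Fin n) ℝ}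
    {C : Matrix (Fin p) (Fin n) ℝ} (hdet : IsDetectable A C) {P : Matrix (Fin n) (Fin n) ℝ}
    (hP : P.PosSemidef)
    (hC : ∀ x, C *ᵥ x ⬝ᵥ C *ᵥ x ≤ quadForm P x - quadForm P (M *ᵥ x))
    (hA : ∀ x, quadForm P x - quadForm P (M *ᵥ x) = 0 → M *ᵥ x = A *ᵥ x) :
    IsSchurStable M := by
  obtain ⟨G, hG⟩ := hdet
  refine isSchurStable_of_forall fun a b c d ha hb hab => ?_
  by_contra! hcd
  have hC0 : ∀ x, 0 ≤ C *ᵥ x ⬝ᵥ C *ᵥ x := fun x => by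
    simpa using dotProduct_star_self_nonneg (C *ᵥ x)
  -- This is v*M*PMv = |z|² v*Pv for the complex eigenvector v = a + ib; the cross terms of the two
  -- real forms cancel.
  have e : quadForm P (M *ᵥ a) + quadForm P (M *ᵥ b)
      = (c ^ 2 + d ^ 2) * (quadForm P a + quadForm P b) := by
    rw [ha, hb, quadForm_sub hP.transpose_eq, quadForm_add hP.transpose_eq]
    simp only [quadForm_smul, mulVec_smul, dotProduct_smul, smul_dotProduct, smul_eq_mul]
    rw [dotProduct_mulVec_comm hP.transpose_eq b a]
    ring
  have e1 := hC a
  have e2 := hC b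
  have e3 := hC0 a
  have e4 := hC0 b
  have e5 : 0 ≤ (c ^ 2 + d ^ 2 - 1) * (quadForm P a + quadForm P b) :=
    mul_nonneg (by linarith) (add_nonneg (hP.quadForm_nonneg a) (hP.quadForm_nonneg b))
  -- If |z| ≥ 1, the decreases of P at a and b have a nonpositive sum, while each is nonnegative;
  -- both vanish. Then C kills a and b, and M acts on them as A, hence as A + GC, which is stable.
  have za : C *ᵥ a = 0 := dotProduct_self_eq_zero.1 (by linarith)
  have zb : C *ᵥ b = 0 := dotProduct_self_eq_zero.1 (by linarith)
  have ga := hA a (by linarith)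
  have gb := hA b (by linarith)
  refine hcd.not_gt (hG.sq_add_sq_lt_one (a := a) (b := b) ?_ ?_ hab)
  · rw [add_mulVec, ← mulVec_mulVec, za, mulVec_zero, add_zero, ← ga, ha]
  · rw [add_mulVec, ← mulVec_mulVec, zb, mulVec_zero, add_zero, ← gb, hb]

/-- Gelfand's formula: for any r strictly between the spectral radius and 1, ‖Mᵏ‖ ≤ rᵏ eventually.
The row-sum norm is convenient because it dominates every entry. -/
lemma IsSchurStable.summable_norm_pow_sq (h : IsSchurStable M) :
    ∃ g : ℕ → ℝ, Summable (fun k => g k ^ 2) ∧ ∀ k i j, |(M ^ k) i j| ≤ g k := by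
  let _ := Matrix.linftyOpNormedRing (n := Fin n) (α := ℂ)
  let _ := Matrix.linftyOpNormedAlgebra (n := Fin n) (R := ℂ) (α := ℂ)
  set N := M.map (algebraMap ℝ ℂ) with hN
  have hg := spectrum.pow_nnnorm_pow_one_div_tendsto_nhds_spectralRadius N
  obtain ⟨r, hr1, hr2⟩ := ENNReal.lt_iff_exists_nnreal_btwn.1 (show spectralRadius ℂ N < 1 from h)
  have hr2' : (r : ℝ) < 1 := by exact_mod_cast hr2
  refine ⟨fun k => ‖N ^ k‖, ?_, fun k i j => ?_⟩
  · refine Summable.of_norm_bounded_eventually_nat (g := fun k => ((r : ℝ) ^ 2) ^ k) ?_ ?_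
    · exact summable_geometric_of_lt_one (by positivity) (by nlinarith [r.2])
    · filter_upwards [hg.eventually_lt_const hr1, eventually_gt_atTop 0] with k hk hk0
      have h1 : (‖N ^ k‖₊ : ENNReal) ≤ (r : ENNReal) ^ k := by
        have := ENNReal.rpow_le_rpow hk.le (Nat.cast_nonneg (α := ℝ) k)
        rw [← ENNReal.rpow_mul, one_div, inv_mul_cancel₀ (by positivity), ENNReal.rpow_one,
          ENNReal.rpow_natCast] at this
        exact this
      have h2 : ‖N ^ k‖ ≤ (r : ℝ) ^ k := by
        rw [← ENNReal.coe_pow, ENNReal.coe_le_coe] at h1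
        exact_mod_cast h1
      rw [Real.norm_of_nonneg (by positivity), ← pow_mul, mul_comm, pow_mul]
      gcongr
  · have h1 : (M ^ k).map (algebraMap ℝ ℂ) = N ^ k := by
      rw [hN, Matrix.map_pow]
    have h2 : |(M ^ k) i j| = ‖(N ^ k) i j‖ := by
      rw [← h1]; simp
    rw [h2]
    have h3 : ‖(N ^ k) i j‖₊ ≤ ‖N ^ k‖₊ := by
      rw [Matrix.linfty_opNNNorm_def]
      exact (Finset.single_le_sum (f := fun j => ‖(N ^ k) i j‖₊) (fun _ _ => zero_le)
        (Finset.mem_univ j)).trans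
        (Finset.le_sup (f := fun i => ∑ j, ‖(N ^ k) i j‖₊) (Finset.mem_univ i))
    exact h3

/-- Solution of the Lyapunov equation of a stable matrix. -/
lemma IsSchurStable.exists_lyapunov (h : IsSchurStable M) :
    ∃ X : Matrix (Fin n) (Fin n) ℝ, X.PosSemidef ∧ X = 1 + Mᵀ * X * M := by
  obtain ⟨g, hg, hgM⟩ := h.summable_norm_pow_sq
  have hs : Summable (fun k => (M ^ k)ᵀ * M ^ k) := by
    refine Pi.summable.2 fun i => Pi.summable.2 fun j => ?_
    refine Summable.of_norm_bounded (hg.mul_left (n : ℝ)) fun k => ?_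
    rw [Matrix.mul_apply]
    refine (norm_sum_le _ _).trans ?_
    have : ∀ l ∈ Finset.univ, ‖(M ^ k)ᵀ i l * (M ^ k) l j‖ ≤ g k ^ 2 := fun l _ => by
      rw [norm_mul, sq, transpose_apply]
      exact mul_le_mul (hgM k l i) (hgM k l j) (norm_nonneg _)
        ((abs_nonneg _).trans (hgM k l i))
    simpa using Finset.sum_le_sum this
  refine ⟨∑' k, (M ^ k)ᵀ * M ^ k, ?_, ?_⟩
  · refine posSemidef_of_quadForm_nonneg ?_ fun x => ?_
    · rw [Matrix.transpose_tsum]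
      simp
    · have hc : Continuous fun P : Matrix (Fin n) (Fin n) ℝ => quadForm P x := by
        unfold quadForm; fun_prop
      refine ge_of_tendsto' ((hc.tendsto _).comp hs.hasSum.tendsto_sum_nat) fun k => ?_
      exact (posSemidef_sum _ fun i _ => by
        simpa using posSemidef_conjTranspose_mul_self (M ^ i)).quadForm_nonneg x
  · conv_lhs => rw [hs.tsum_eq_zero_add]
    congr 1
    · simp
    · rw [← hs.tsum_mul_left, ← (hs.mul_left _).tsum_mul_right]
      refine tsum_congr fun k => ?_
      simp only [pow_succ, transpose_mul, Matrix.mul_assoc]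

end Stability


/-! ### Limits of matrices -/

section Limits

open scoped Topology

lemma Filter.Tendsto.matrix_mul {l m k : Type*} [Fintype m] {ι : Type*}
    {𝓕 : Filter ι} {f : ι → Matrix l m ℝ} {g : ι → Matrix m k ℝ} {X : Matrix l m ℝ}
    {Y : Matrix m k ℝ} (hf : Tendsto f 𝓕 (𝓝 X)) (hg : Tendsto g 𝓕 (𝓝 Y)) :
    Tendsto (fun k => f k * g k) 𝓕 (𝓝 (X * Y)) :=
  ((continuous_fst.matrix_mul continuous_snd).tendsto (X, Y)).comp (hf.prodMk_nhds hg)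

variable {n : Type*} [Fintype n]

lemma continuous_quadForm (x : n → ℝ) : Continuous fun P : Matrix n n ℝ => quadForm P x := by
  unfold quadForm
  fun_prop

lemma Filter.Tendsto.matrix_inv [DecidableEq n] {ι : Type*} {l : Filter ι}
    {f : ι → Matrix n n ℝ} {N : Matrix n n ℝ} (hf : Tendsto f l (𝓝 N)) (hN : IsUnit N.det) :
    Tendsto (fun k => (f k)⁻¹) l (𝓝 N⁻¹) := by
  simp only [Matrix.inv_def, Ring.inverse_eq_inv']
  exact ((((continuous_id.matrix_det).tendsto N).comp hf).inv₀ hN.ne_zero).smul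
    (((continuous_id.matrix_adjugate).tendsto N).comp hf)

/-- A monotone sequence of symmetric matrices that is bounded above converges. -/
lemma exists_tendsto_of_monotone_quadForm {P : ℕ → Matrix n n ℝ} (hP : ∀ k, (P k)ᵀ = P k)
    {P' : Matrix n n ℝ} (hmono : ∀ k x, quadForm (P k) x ≤ quadForm (P (k + 1)) x)
    (hle : ∀ k x, quadForm (P k) x ≤ quadForm P' x) :
    ∃ N, Tendsto P atTop (𝓝 N) := by
  classical
  have hq : ∀ x, ∃ q, Tendsto (fun k => quadForm (P k) x) atTop (𝓝 q) := fun x =>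
    ⟨_, tendsto_atTop_ciSup (monotone_nat_of_le_succ fun k => hmono k x)
      ⟨quadForm P' x, by rintro _ ⟨k, rfl⟩; exact hle k x⟩⟩
  choose q hq using hq
  -- Polarization: the entries of the limit are recovered from the limits of the quadratic forms at
  -- eᵢ, eⱼ and eᵢ + eⱼ.
  refine ⟨fun i j => (q (Pi.single j 1 + Pi.single i 1) - q (Pi.single j 1)
    - q (Pi.single i 1)) / 2, tendsto_pi_nhds.2 fun i => tendsto_pi_nhds.2 fun j => ?_⟩
  refine ((((hq _).sub (hq _)).sub (hq _)).div_const 2).congr fun k => ?_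
  rw [quadForm_add (hP k)]
  simp only [mulVec_single_one, single_one_dotProduct, col_apply]
  ring

lemma Matrix.PosSemidef.of_tendsto {P : ℕ → Matrix n n ℝ} {N : Matrix n n ℝ}
    (h : Tendsto P atTop (𝓝 N)) (hP : ∀ k, (P k).PosSemidef) : N.PosSemidef := by
  refine posSemidef_of_quadForm_nonneg ?_ fun x => ?_
  · refine tendsto_nhds_unique (((continuous_id.matrix_transpose).tendsto N).comp h) ?_
    exact h.congr fun k => (hP k).transpose_eq.symm
  · exact ge_of_tendsto' (((continuous_quadForm x).tendsto N).comp h)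
      fun k => (hP k).quadForm_nonneg x

end Limits

/-! ### Value iteration and the least solution; stability of the gains -/

namespace LQSystem

open scoped Topology

variable {nx nw nd nu : ℕ} {S : LQSystem nx nw nd nu} {γ : ℝ} {P P' : Matrix (Fin nx) (Fin nx) ℝ}

lemma IsAdmissible.tendsto_gameM (h : S.IsAdmissible γ P) {f : ℕ → Matrix (Fin nx) (Fin nx) ℝ}
    (hf : Tendsto f atTop (𝓝 P)) :
    Tendsto (fun k => S.gameM γ (f k)) atTop (𝓝 (S.gameM γ P)) := by
  have hW : Tendsto (fun k => S.advWeight γ (f k)) atTop (𝓝 (S.advWeight γ P)) :=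
    tendsto_const_nhds.sub ((tendsto_const_nhds.matrix_mul hf).matrix_mul tendsto_const_nhds)
  have hi := hW.matrix_inv h.2.isUnit_det_real
  exact hf.add ((((hf.matrix_mul tendsto_const_nhds).matrix_mul hi).matrix_mul
    tendsto_const_nhds).matrix_mul hf)

lemma IsAdmissible.tendsto_riccati (h : S.IsAdmissible γ P) (hR : S.R.PosDef)
    {f : ℕ → Matrix (Fin nx) (Fin nx) ℝ} (hf : Tendsto f atTop (𝓝 P)) :
    Tendsto (fun k => S.riccati γ (f k)) atTop (𝓝 (S.riccati γ P)) := by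
  have hM := h.tendsto_gameM hf
  have hH : Tendsto (fun k => S.inputWeight γ (f k)) atTop (𝓝 (S.inputWeight γ P)) :=
    tendsto_const_nhds.add ((tendsto_const_nhds.matrix_mul hM).matrix_mul tendsto_const_nhds)
  have hi := hH.matrix_inv (h.inputWeight_posDef hR).isUnit_det_real
  have hG : Tendsto (fun k => S.B₂ᵀ * S.gameM γ (f k) * S.A) atTop
      (𝓝 (S.B₂ᵀ * S.gameM γ P * S.A)) :=
    (tendsto_const_nhds.matrix_mul hM).matrix_mul tendsto_const_nhds
  have hGt : Tendsto (fun k => (S.B₂ᵀ * S.gameM γ (f k) * S.A)ᵀ) atTop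
      (𝓝 (S.B₂ᵀ * S.gameM γ P * S.A)ᵀ) :=
    ((continuous_id.matrix_transpose).tendsto _).comp hG
  exact (tendsto_const_nhds.add
    ((tendsto_const_nhds.matrix_mul hM).matrix_mul tendsto_const_nhds)).sub
    ((hGt.matrix_mul hi).matrix_mul hG)

/-- Value iteration started at zero. -/
def valueIter (S : LQSystem nx nw nd nu) (γ : ℝ) (k : ℕ) : Matrix (Fin nx) (Fin nx) ℝ :=
  (S.riccati γ)^[k] 0

lemma valueIter_zero : S.valueIter γ 0 = 0 := rfl

lemma valueIter_succ (k : ℕ) : S.valueIter γ (k + 1) = S.riccati γ (S.valueIter γ k) :=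
  Function.iterate_succ_apply' _ _ _

/-- Induction on monotonicity: 0 ≤ P, and a solution P is a fixed point. Each new bound also gives
admissibility of the next iterate through `IsAdmissible.mono`. -/
lemma valueIter_le (hQ : S.Q.PosSemidef) (hR : S.R.PosDef) (hP : S.IsGameSolution γ P) (k : ℕ) :
    S.IsAdmissible γ (S.valueIter γ k) ∧ (P - S.valueIter γ k).PosSemidef := by
  obtain ⟨hP1, hP2⟩ := (isGameSolution_iff hR).1 hP
  induction k with
  | zero =>
    have h : (P - S.valueIter γ 0).PosSemidef := by simpa [valueIter_zero] using hP1.1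
    exact ⟨hP1.mono .zero h, h⟩
  | succ k ih =>
    have h : (P - S.valueIter γ (k + 1)).PosSemidef := by
      have := ih.1.riccati_mono hP1 hQ hR ih.2
      rwa [hP2, ← valueIter_succ] at this
    refine ⟨hP1.mono ?_ h, h⟩
    rw [valueIter_succ]
    exact ih.1.riccati_posSemidef hQ hR

lemma valueIter_mono (hQ : S.Q.PosSemidef) (hR : S.R.PosDef) (hP : S.IsGameSolution γ P) (k : ℕ) :
    (S.valueIter γ (k + 1) - S.valueIter γ k).PosSemidef := by
  induction k with
  | zero => simpa [valueIter_zero] using (valueIter_le hQ hR hP 1).1.1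
  | succ k ih =>
    have := (valueIter_le hQ hR hP k).1.riccati_mono (valueIter_le hQ hR hP (k + 1)).1 hQ hR ih
    rwa [← valueIter_succ, ← valueIter_succ] at this

/-- Value iteration converges to the least solution. -/
lemma exists_isLeastGameSolution (hQ : S.Q.PosSemidef) (hR : S.R.PosDef)
    (hex : ∃ P, S.IsGameSolution γ P) :
    ∃ P, S.IsLeastGameSolution γ P ∧ Tendsto (S.valueIter γ) atTop (𝓝 P) := by
  obtain ⟨P₀, h₀⟩ := hex
  obtain ⟨P, hP⟩ := exists_tendsto_of_monotone_quadForm (P := S.valueIter γ) (P' := P₀)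
    (fun k => (valueIter_le hQ hR h₀ k).1.1.transpose_eq)
    (fun k x => by
      have := (valueIter_mono hQ hR h₀ k).quadForm_nonneg x
      rw [quadForm_matrix_sub] at this
      linarith)
    (fun k x => by
      have := (valueIter_le hQ hR h₀ k).2.quadForm_nonneg x
      rw [quadForm_matrix_sub] at this
      linarith)
  have hle : ∀ P', S.IsGameSolution γ P' → (P' - P).PosSemidef := fun P' h' =>
    .of_tendsto (tendsto_const_nhds.sub hP) fun k => (valueIter_le hQ hR h' k).2
  -- The limit lies below the given solution, so `advWeight` remains positive definite at the limit
  -- and `riccati` is continuous there.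
  have hadm : S.IsAdmissible γ P := ((isGameSolution_iff hR).1 h₀).1.mono
    (.of_tendsto hP fun k => (valueIter_le hQ hR h₀ k).1.1) (hle P₀ h₀)
  refine ⟨P, ⟨(isGameSolution_iff hR).2 ⟨hadm, ?_⟩, hle⟩, hP⟩
  refine tendsto_nhds_unique (hadm.tendsto_riccati hR hP) ?_
  exact ((tendsto_add_atTop_iff_nat 1).2 hP).congr fun k => valueIter_succ k

lemma sqrt_mulVec_dotProduct_self {n : ℕ} {Q : Matrix (Fin n) (Fin n) ℝ} (hQ : Q.PosSemidef)
    (x : Fin n → ℝ) : CFC.sqrt Q *ᵥ x ⬝ᵥ CFC.sqrt Q *ᵥ x = quadForm Q x := by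
  have h0 : (CFC.sqrt Q).PosSemidef := by
    have := CFC.sqrt_nonneg Q
    rwa [Matrix.nonneg_iff_posSemidef] at this
  rw [dotProduct_mulVec_transpose, h0.transpose_eq, mulVec_mulVec, CFC.sqrt_mul_sqrt_self Q
    (Matrix.nonneg_iff_posSemidef.2 hQ), quadForm, dotProduct_comm]

lemma C₁_mulVec_add_D₁₂_mulVec (x : Fin nx → ℝ) (u : Fin nu → ℝ) :
    S.C₁ *ᵥ x + S.D₁₂ *ᵥ u = Sum.elim (CFC.sqrt S.Q *ᵥ x) (CFC.sqrt S.R *ᵥ u) := by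
  rw [C₁, D₁₂, fromRows_mulVec, fromRows_mulVec]
  ext (i | i) <;> simp

lemma perf_dotProduct_self (hQ : S.Q.PosSemidef) (hR : S.R.PosDef) (x : Fin nx → ℝ)
    (u : Fin nu → ℝ) :
    (S.C₁ *ᵥ x + S.D₁₂ *ᵥ u) ⬝ᵥ (S.C₁ *ᵥ x + S.D₁₂ *ᵥ u) = quadForm S.Q x + quadForm S.R u := by
  rw [C₁_mulVec_add_D₁₂_mulVec, sumElim_dotProduct_sumElim, sqrt_mulVec_dotProduct_self hQ,
    sqrt_mulVec_dotProduct_self hR.posSemidef]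

/-- The gain of any admissible Riccati solution is stabilizing. -/
lemma IsGameSolution.isSchurStable (h : S.IsGameSolution γ P) (hQ : S.Q.PosSemidef)
    (hR : S.R.PosDef) (hdet : IsDetectable S.A (CFC.sqrt S.Q)) :
    IsSchurStable (S.A + S.B₂ * S.gainF γ P) := by
  obtain ⟨hP, hric⟩ := (isGameSolution_iff hR).1 h
  rw [hP.gainF_eq hR]
  -- The Riccati equation along the optimal input, with M weakened to P: switching the adversary off
  -- leaves a dissipation inequality. Zero decrease then forces the input Fx to vanish, since R ≻ 0.
  have key : ∀ x, quadForm S.Q x + quadForm S.R (S.inputGain γ P *ᵥ x)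
      ≤ quadForm P x - quadForm P ((S.A + S.B₂ * S.inputGain γ P) *ᵥ x) := fun x => by
    have e := hP.quadForm_add_input hR x (S.inputGain γ P *ᵥ x)
    rw [sub_self, quadForm_zero, hric, mulVec_mulVec, ← add_mulVec] at e
    linarith [hP.quadForm_le_gameM ((S.A + S.B₂ * S.inputGain γ P) *ᵥ x)]
  refine hdet.isSchurStable_of_lyapunov hP.1 (fun x => ?_) fun x hx => ?_
  · rw [sqrt_mulVec_dotProduct_self hQ]
    linarith [key x, hR.posSemidef.quadForm_nonneg (S.inputGain γ P *ᵥ x)]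
  · have h1 := key x
    have h2 := hR.posSemidef.quadForm_nonneg (S.inputGain γ P *ᵥ x)
    have h3 := hQ.quadForm_nonneg x
    have h4 : S.inputGain γ P *ᵥ x = 0 := hR.eq_zero_of_quadForm_eq_zero (by linarith)
    rw [add_mulVec, ← mulVec_mulVec, h4, mulVec_zero, add_zero]

end LQSystem

/-! ### Square-integrable random vectors -/

section RandomVectors

variable {m n : Type*} [Fintype n] {Ω : Type*}

lemma Measurable.matrix_mulVec {mΩ : MeasurableSpace Ω} {f : Ω → n → ℝ} (hf : Measurable f)
    (N : Matrix m n ℝ) : Measurable fun ω => N *ᵥ f ω :=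
  measurable_pi_iff.2 fun i => Finset.measurable_sum _ fun j _ =>
    ((measurable_pi_apply j).comp hf).const_mul (N i j)

variable [MeasurableSpace Ω] {μ : Measure Ω}

lemma integral_mulVec_eq_zero [IsFiniteMeasure μ] {v : Ω → n → ℝ} (hv : MemLp v 2 μ)
    (h0 : ∀ i, ∫ ω, v ω i ∂μ = 0)
    (N : Matrix m n ℝ) (i : m) : ∫ ω, (N *ᵥ v ω) i ∂μ = 0 := by
  simp only [mulVec, dotProduct]
  rw [integral_finsetSum _ fun j _ =>
    ((hv.eval j).integrable (by norm_num)).const_mul (N i j)]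
  simp [integral_const_mul, h0]

variable [Fintype m]

lemma MeasureTheory.MemLp.matrix_mulVec {f : Ω → n → ℝ} (hf : MemLp f 2 μ) (N : Matrix m n ℝ) :
    MemLp (fun ω => N *ᵥ f ω) 2 μ :=
  MemLp.of_eval fun i => memLp_finsetSum _ fun j _ => (hf.eval j).const_mul (N i j)

lemma MeasureTheory.MemLp.integrable_dotProduct {f g : Ω → n → ℝ} (hf : MemLp f 2 μ)
    (hg : MemLp g 2 μ) : Integrable (fun ω => f ω ⬝ᵥ g ω) μ :=
  integrable_finsetSum _ fun i _ => (hf.eval i).integrable_mul (hg.eval i)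

lemma MeasureTheory.MemLp.integrable_quadForm {f : Ω → n → ℝ} (hf : MemLp f 2 μ)
    (P : Matrix n n ℝ) : Integrable (fun ω => quadForm P (f ω)) μ :=
  hf.integrable_dotProduct (hf.matrix_mulVec P)

lemma memLp_two_of_integrable_dotProduct_self {f : Ω → n → ℝ} (hf : Measurable f)
    (h : Integrable (fun ω => f ω ⬝ᵥ f ω) μ) : MemLp f 2 μ := by
  refine MemLp.of_eval fun i => ?_
  have hfi : Measurable fun ω => f ω i := (measurable_pi_apply i).comp hf
  rw [memLp_two_iff_integrable_sq hfi.aestronglyMeasurable]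
  refine h.mono' (hfi.pow_const 2).aestronglyMeasurable (ae_of_all _ fun ω => ?_)
  rw [Real.norm_of_nonneg (sq_nonneg _), sq]
  exact Finset.single_le_sum (f := fun i => f ω i * f ω i) (fun i _ => mul_self_nonneg _)
    (Finset.mem_univ i)

lemma integral_dotProduct_eq_zero_of_indepFun {y v : Ω → n → ℝ} (hy : MemLp y 2 μ)
    (hv : MemLp v 2 μ) (hind : IndepFun y v μ) (h0 : ∀ i, ∫ ω, v ω i ∂μ = 0) :
    ∫ ω, y ω ⬝ᵥ v ω ∂μ = 0 := by
  have hint : ∀ i, Integrable (fun ω => y ω i * v ω i) μ := fun i =>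
    (hy.eval i).integrable_mul (hv.eval i)
  simp only [dotProduct]
  rw [integral_finsetSum _ fun i _ => hint i]
  refine Finset.sum_eq_zero fun i _ => ?_
  have hi : IndepFun (fun ω => y ω i) (fun ω => v ω i) μ :=
    hind.comp (measurable_pi_apply i) (measurable_pi_apply i)
  rw [hi.integral_fun_mul_eq_mul_integral (hy.eval i).aestronglyMeasurable
    (hv.eval i).aestronglyMeasurable, h0, mul_zero]

/-- Expand in entries: E[vᵢvⱼ] = δᵢⱼ keeps only the diagonal of N. -/
lemma integral_quadForm_of_cov_one [DecidableEq n] {v : Ω → n → ℝ} (hv : MemLp v 2 μ)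
    (hcov : ∀ i j, ∫ ω, v ω i * v ω j ∂μ = (1 : Matrix n n ℝ) i j) (N : Matrix n n ℝ) :
    ∫ ω, quadForm N (v ω) ∂μ = N.trace := by
  have h : ∀ ω, quadForm N (v ω) = ∑ i, ∑ j, N i j * (v ω i * v ω j) := fun ω => by
    simp only [quadForm, dotProduct, mulVec, Finset.mul_sum]
    exact Finset.sum_congr rfl fun i _ => Finset.sum_congr rfl fun j _ => by ring
  have hint : ∀ i j, Integrable (fun ω => N i j * (v ω i * v ω j)) μ := fun i j =>
    ((hv.eval i).integrable_mul (hv.eval j)).const_mul _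
  simp_rw [h]
  rw [integral_finsetSum _ fun i _ => integrable_finsetSum _ fun j _ => hint i j]
  refine Finset.sum_congr rfl fun i _ => ?_
  rw [integral_finsetSum _ fun j _ => hint i j]
  simp [integral_const_mul, hcov, Matrix.one_apply]

/-- Second moment of a random vector plus independent white noise. -/
lemma integral_quadForm_add_noise [IsFiniteMeasure μ] [DecidableEq n] {y : Ω → m → ℝ}
    {v : Ω → n → ℝ}
    (hy : MemLp y 2 μ) (hv : MemLp v 2 μ) (hind : IndepFun y v μ)
    (h0 : ∀ i, ∫ ω, v ω i ∂μ = 0)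
    (hcov : ∀ i j, ∫ ω, v ω i * v ω j ∂μ = (1 : Matrix n n ℝ) i j)
    {M : Matrix m m ℝ} (hM : Mᵀ = M) (B : Matrix m n ℝ) :
    ∫ ω, quadForm M (y ω + B *ᵥ v ω) ∂μ = ∫ ω, quadForm M (y ω) ∂μ + (M * (B * Bᵀ)).trace := by
  have e : ∀ ω, quadForm M (y ω + B *ᵥ v ω)
      = quadForm M (y ω) + 2 * (y ω ⬝ᵥ (M * B) *ᵥ v ω) + quadForm (Bᵀ * M * B) (v ω) := fun ω => by
    rw [quadForm_add hM, quadForm_mulVec, dotProduct_mulVec_comm hM (B *ᵥ v ω), mulVec_mulVec]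
  have hMB := hv.matrix_mulVec (M * B)
  have h1 := hy.integrable_quadForm M
  have h2 := (hy.integrable_dotProduct hMB).const_mul 2
  have h12 : Integrable (fun ω => quadForm M (y ω) + 2 * (y ω ⬝ᵥ (M * B) *ᵥ v ω)) μ := h1.add h2
  have hind' : IndepFun y (fun ω => (M * B) *ᵥ v ω) μ :=
    hind.comp measurable_id (measurable_id.matrix_mulVec (M * B))
  simp_rw [e]
  rw [integral_add h12 (hv.integrable_quadForm _), integral_add h1 h2,
    integral_const_mul, integral_dotProduct_eq_zero_of_indepFun hy hMB hind'
    (integral_mulVec_eq_zero hv h0 _), integral_quadForm_of_cov_one hv hcov, mul_zero, add_zero,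
    ← Matrix.mul_assoc, Matrix.trace_mul_comm (M * B), Matrix.mul_assoc]

end RandomVectors

/-- The joint law of (f, g, h) factors as a threefold product, and reassociating that product
separates (f, g) from h. -/
lemma ProbabilityTheory.IndepFun.prodMk_left {Ω α β δ : Type*} [MeasurableSpace Ω]
    [MeasurableSpace α] [MeasurableSpace β] [MeasurableSpace δ] {μ : Measure Ω}
    [IsProbabilityMeasure μ] {f : Ω → α} {g : Ω → β} {h : Ω → δ} (hf : Measurable f)
    (hg : Measurable g) (hh : Measurable h) (hfgh : IndepFun f (fun ω => (g ω, h ω)) μ)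
    (hgh : IndepFun g h μ) : IndepFun (fun ω => (f ω, g ω)) h μ := by
  have hfg : IndepFun f g μ := hfgh.comp measurable_id measurable_fst
  have := Measure.isProbabilityMeasure_map (μ := μ) hf.aemeasurable
  have := Measure.isProbabilityMeasure_map (μ := μ) hg.aemeasurable
  have := Measure.isProbabilityMeasure_map (μ := μ) hh.aemeasurable
  rw [indepFun_iff_map_prod_eq_prod_map_map (hf.prodMk hg).aemeasurable hh.aemeasurable,
    (indepFun_iff_map_prod_eq_prod_map_map hf.aemeasurable hg.aemeasurable).1 hfg]
  have e1 := (indepFun_iff_map_prod_eq_prod_map_map hf.aemeasurable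
    (hg.prodMk hh).aemeasurable).1 hfgh
  rw [(indepFun_iff_map_prod_eq_prod_map_map hg.aemeasurable hh.aemeasurable).1 hgh,
    ← Measure.prodAssoc_prod] at e1
  have e2 := congrArg (Measure.map (MeasurableEquiv.prodAssoc (α := α) (β := β) (γ := δ)).symm) e1
  rw [MeasurableEquiv.map_symm_map, Measure.map_map (MeasurableEquiv.measurable _)
    (hf.prodMk (hg.prodMk hh))] at e2
  exact e2

namespace LQSystem

variable {nx nw nd nu : ℕ} {Ω : Type*}

/-! ### Information and noise -/

/-- The σ-algebra of `x_0, w_0, …, w_{t-1}`. -/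
@[reducible]
def infoSigma (x₀ : Ω → Fin nx → ℝ) (w : ℕ → Ω → Fin nw → ℝ) (t : ℕ) : MeasurableSpace Ω :=
  MeasurableSpace.comap (fun ω => (x₀ ω, fun s : Fin t => w s ω)) inferInstance

section Info

variable {x₀ : Ω → Fin nx → ℝ} {w : ℕ → Ω → Fin nw → ℝ}

lemma measurable_infoSigma_x₀ (t : ℕ) : Measurable[infoSigma x₀ w t] x₀ :=
  measurable_fst.comp (comap_measurable _)

lemma measurable_infoSigma_w {s t : ℕ} (h : s < t) : Measurable[infoSigma x₀ w t] (w s) := by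
  have h1 : Measurable[infoSigma x₀ w t] fun ω => (x₀ ω, fun s : Fin t => w s ω) :=
    comap_measurable _
  exact ((measurable_pi_apply (⟨s, h⟩ : Fin t)).comp measurable_snd).comp h1

lemma infoSigma_le_of_measurable {m : MeasurableSpace Ω} {t : ℕ} (hx : Measurable x₀)
    (hw : ∀ s < t, Measurable (w s)) : infoSigma x₀ w t ≤ m :=
  Measurable.comap_le (hx.prodMk (measurable_pi_iff.2 fun i => hw i i.2))

lemma infoSigma_mono {s t : ℕ} (h : s ≤ t) : infoSigma x₀ w s ≤ infoSigma x₀ w t :=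
  infoSigma_le_of_measurable (measurable_infoSigma_x₀ t)
    fun _ hi => measurable_infoSigma_w (hi.trans_le h)

namespace IsNoise

variable [MeasurableSpace Ω] {μ : Measure Ω}

lemma infoSigma_le (hn : IsNoise μ x₀ w) (t : ℕ) : infoSigma x₀ w t ≤ ‹MeasurableSpace Ω› :=
  infoSigma_le_of_measurable hn.measurable_x₀ fun s _ => hn.measurable_w s

/-- The past noise is independent of w_t by mutual independence, and x₀ is independent of the whole
noise sequence; `IndepFun.prodMk_left` combines the two into independence of the full past. -/
lemma indepFun_w [IsProbabilityMeasure μ] (hn : IsNoise μ x₀ w) {t : ℕ} {E : Type*}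
    [MeasurableSpace E] {f : Ω → E} (hf : Measurable[infoSigma x₀ w t] f) :
    IndepFun f (w t) μ := by
  have h1 : IndepFun (fun ω (s : Fin t) => w s ω) (w t) μ := by
    have := hn.iIndepFun_w.indepFun_finset (Finset.range t) {t} (by simp) hn.measurable_w
    have hφ : Measurable fun (v : Finset.range t → Fin nw → ℝ) (s : Fin t) =>
        v ⟨s, Finset.mem_range.2 s.2⟩ := measurable_pi_iff.2 fun s => measurable_pi_apply _
    have hψ : Measurable fun v : ({t} : Finset ℕ) → Fin nw → ℝ =>
        v ⟨t, Finset.mem_singleton_self t⟩ := measurable_pi_apply _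
    exact this.comp hφ hψ
  have h2 : IndepFun x₀ (fun ω => ((fun s : Fin t => w s ω), w t ω)) μ := by
    have hψ : Measurable fun v : ℕ → Fin nw → ℝ => ((fun s : Fin t => v s), v t) :=
      (measurable_pi_iff.2 fun s => measurable_pi_apply _).prodMk (measurable_pi_apply _)
    exact hn.indepFun_x₀_w.comp measurable_id hψ
  have h3 := h2.prodMk_left hn.measurable_x₀
    (measurable_pi_iff.2 fun s : Fin t => hn.measurable_w s) (hn.measurable_w t) h1
  rw [IndepFun_iff_Indep] at h3 ⊢
  exact indep_of_indep_of_le_left h3 hf.comap_le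

end IsNoise

end Info

variable [MeasurableSpace Ω] {S : LQSystem nx nw nd nu}

/-! ### One step of the game in expectation -/

/-- Expected increment of the payoff plus the value at the successor state. -/
lemma IsAdmissible.integral_step {γ : ℝ} {P : Matrix (Fin nx) (Fin nx) ℝ}
    (h : S.IsAdmissible γ P) (hR : S.R.PosDef) {μ : Measure Ω} [IsProbabilityMeasure μ]
    {x₀ : Ω → Fin nx → ℝ} {w : ℕ → Ω → Fin nw → ℝ} (hn : IsNoise μ x₀ w) {t : ℕ}
    {x : Ω → Fin nx → ℝ} {u : Ω → Fin nu → ℝ} {d : Ω → Fin nd → ℝ}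
    (hxm : Measurable[infoSigma x₀ w t] x) (hum : Measurable[infoSigma x₀ w t] u)
    (hx : MemLp x 2 μ) (hu : MemLp u 2 μ) (hd : MemLp d 2 μ) :
    ∫ ω, (quadForm S.Q (x ω) + quadForm S.R (u ω) - γ ^ 2 * (d ω ⬝ᵥ d ω)) ∂μ
      + ∫ ω, quadForm P (S.A *ᵥ x ω + S.B₀ *ᵥ w t ω + S.B₁ *ᵥ d ω + S.B₂ *ᵥ u ω) ∂μ
    = ∫ ω, quadForm (S.riccati γ P) (x ω) ∂μ
      + ∫ ω, quadForm (S.inputWeight γ P) (u ω - S.inputGain γ P *ᵥ x ω) ∂μ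
      + (S.gameM γ P * (S.B₀ * S.B₀ᵀ)).trace
      - ∫ ω, quadForm (S.advWeight γ P)
          (d ω - S.advGain γ P *ᵥ (S.A *ᵥ x ω + S.B₂ *ᵥ u ω + S.B₀ *ᵥ w t ω)) ∂μ := by
  have hw := hn.memLp_w t
  have hy : MemLp (fun ω => S.A *ᵥ x ω + S.B₂ *ᵥ u ω) 2 μ :=
    (hx.matrix_mulVec S.A).add (hu.matrix_mulVec S.B₂)
  have hyw : MemLp (fun ω => S.A *ᵥ x ω + S.B₂ *ᵥ u ω + S.B₀ *ᵥ w t ω) 2 μ :=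
    hy.add (hw.matrix_mulVec S.B₀)
  have hx' : MemLp (fun ω => S.A *ᵥ x ω + S.B₂ *ᵥ u ω + S.B₀ *ᵥ w t ω + S.B₁ *ᵥ d ω) 2 μ :=
    hyw.add (hd.matrix_mulVec S.B₁)
  have hdd : MemLp (fun ω => d ω
      - S.advGain γ P *ᵥ (S.A *ᵥ x ω + S.B₂ *ᵥ u ω + S.B₀ *ᵥ w t ω)) 2 μ :=
    hd.sub (hyw.matrix_mulVec (S.advGain γ P))
  have huu : MemLp (fun ω => u ω - S.inputGain γ P *ᵥ x ω) 2 μ :=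
    hu.sub (hx.matrix_mulVec (S.inputGain γ P))
  have hym : Measurable[infoSigma x₀ w t] fun ω => S.A *ᵥ x ω + S.B₂ *ᵥ u ω :=
    (hxm.matrix_mulVec S.A).add (hum.matrix_mulVec S.B₂)
  -- The state and the input are known before w_t is drawn, so the cross term has mean zero. The
  -- perturbation may depend on w_t, but it has already been maximized out into M.
  have hnoise := integral_quadForm_add_noise hy hw (hn.indepFun_w hym) (hn.mean_w t) (hn.cov_w t)
    h.gameM_posSemidef.transpose_eq S.B₀
  have i1 := hx.integrable_quadForm S.Q
  have i2 := hu.integrable_quadForm S.R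
  have i3 := (hd.integrable_dotProduct hd).const_mul (γ ^ 2)
  have i4 := hx'.integrable_quadForm P
  have i5 := hyw.integrable_quadForm (S.gameM γ P)
  have i6 := hdd.integrable_quadForm (S.advWeight γ P)
  have i7 := hy.integrable_quadForm (S.gameM γ P)
  have i8 := hx.integrable_quadForm (S.riccati γ P)
  have i9 := huu.integrable_quadForm (S.inputWeight γ P)
  have i12 : Integrable (fun ω => quadForm S.Q (x ω) + quadForm S.R (u ω)) μ := i1.add i2
  have e1 : ∫ ω, quadForm S.Q (x ω) ∂μ + ∫ ω, quadForm S.R (u ω) ∂μ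
      + ∫ ω, quadForm (S.gameM γ P) (S.A *ᵥ x ω + S.B₂ *ᵥ u ω) ∂μ
      = ∫ ω, quadForm (S.riccati γ P) (x ω) ∂μ
      + ∫ ω, quadForm (S.inputWeight γ P) (u ω - S.inputGain γ P *ᵥ x ω) ∂μ := by
    rw [← integral_add i1 i2, ← integral_add i12 i7, ← integral_add i8 i9]
    exact integral_congr_ae (ae_of_all _ fun ω => h.quadForm_add_input hR (x ω) (u ω))
  have e2 : ∫ ω, quadForm P (S.A *ᵥ x ω + S.B₂ *ᵥ u ω + S.B₀ *ᵥ w t ω + S.B₁ *ᵥ d ω) ∂μ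
      - ∫ ω, γ ^ 2 * (d ω ⬝ᵥ d ω) ∂μ
      = ∫ ω, quadForm (S.gameM γ P) (S.A *ᵥ x ω + S.B₂ *ᵥ u ω + S.B₀ *ᵥ w t ω) ∂μ
      - ∫ ω, quadForm (S.advWeight γ P)
          (d ω - S.advGain γ P *ᵥ (S.A *ᵥ x ω + S.B₂ *ᵥ u ω + S.B₀ *ᵥ w t ω)) ∂μ := by
    rw [← integral_sub i4 i3, ← integral_sub i5 i6]
    exact integral_congr_ae (ae_of_all _ fun ω => h.quadForm_add_perturbation _ (d ω))
  have e3 : ∀ ω, S.A *ᵥ x ω + S.B₀ *ᵥ w t ω + S.B₁ *ᵥ d ω + S.B₂ *ᵥ u ω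
      = S.A *ᵥ x ω + S.B₂ *ᵥ u ω + S.B₀ *ᵥ w t ω + S.B₁ *ᵥ d ω := fun ω => by abel
  simp_rw [e3]
  rw [integral_sub i12 i3, integral_add i1 i2]
  linarith

end LQSystem

namespace LQSystem

variable {nx nw nd nu : ℕ} {S : LQSystem nx nw nd nu} {κ : Controller nx nu}

/-! ### Closed-loop trajectories -/

section Deterministic

variable {x₀ : Fin nx → ℝ} {w : ℕ → Fin nw → ℝ} {δ δ' : ℕ → Fin nd → ℝ}

lemma state_zero : S.state κ x₀ w δ 0 = x₀ := rfl

lemma state_succ (t : ℕ) : S.state κ x₀ w δ (t + 1) = S.A *ᵥ S.state κ x₀ w δ t + S.B₀ *ᵥ w t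
    + S.B₁ *ᵥ δ t + S.B₂ *ᵥ S.input κ x₀ w δ t := by
  rw [state, stateHistory, Fin.snoc_last]
  rfl

lemma perf_sq (hQ : S.Q.PosSemidef) (hR : S.R.PosDef) (t : ℕ) :
    S.perf κ x₀ w δ t ⬝ᵥ S.perf κ x₀ w δ t
      = quadForm S.Q (S.state κ x₀ w δ t) + quadForm S.R (S.input κ x₀ w δ t) :=
  perf_dotProduct_self hQ hR _ _

/-- δ_t first acts on x_{t+1}, hence the strict inequality. Perturbations can thus be truncated at a
time n without changing the input at n. -/
lemma stateHistory_congr {t : ℕ} (h : ∀ s < t, δ s = δ' s) :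
    S.stateHistory κ x₀ w δ t = S.stateHistory κ x₀ w δ' t := by
  induction t with
  | zero => rfl
  | succ t ih =>
    rw [stateHistory, stateHistory, ih fun s hs => h s (hs.trans t.lt_succ_self),
      h t t.lt_succ_self]

/-- The state history when the perturbation follows the strategy `φ`. -/
def strategyHistory (S : LQSystem nx nw nd nu) (κ : Controller nx nu)
    (φ : (t : ℕ) → (Fin (t + 1) → Fin nx → ℝ) → (Fin nw → ℝ) → Fin nd → ℝ)
    (x₀ : Fin nx → ℝ) (w : ℕ → Fin nw → ℝ) : (t : ℕ) → Fin (t + 1) → Fin nx → ℝ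
  | 0 => fun _ => x₀
  | t + 1 =>
    Fin.snoc (α := fun _ => Fin nx → ℝ) (strategyHistory S κ φ x₀ w t)
      (S.A *ᵥ strategyHistory S κ φ x₀ w t (Fin.last t) + S.B₀ *ᵥ w t
        + S.B₁ *ᵥ φ t (strategyHistory S κ φ x₀ w t) (w t)
        + S.B₂ *ᵥ κ t (strategyHistory S κ φ x₀ w t))

/-- Every strategy is realized by a perturbation sequence. -/
lemma exists_perturbation_of_strategy (S : LQSystem nx nw nd nu) (κ : Controller nx nu)
    (φ : (t : ℕ) → (Fin (t + 1) → Fin nx → ℝ) → (Fin nw → ℝ) → Fin nd → ℝ)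
    (x₀ : Fin nx → ℝ) (w : ℕ → Fin nw → ℝ) :
    ∃ δ : ℕ → Fin nd → ℝ, ∀ t, δ t = φ t (S.stateHistory κ x₀ w δ t) (w t) := by
  refine ⟨fun t => φ t (S.strategyHistory κ φ x₀ w t) (w t), fun t => ?_⟩
  have h : ∀ t, S.stateHistory κ x₀ w (fun t => φ t (S.strategyHistory κ φ x₀ w t) (w t)) t
      = S.strategyHistory κ φ x₀ w t := fun t => by
    induction t with
    | zero => rfl
    | succ t ih => rw [stateHistory, strategyHistory, ih]
  rw [h]

end Deterministic

section Stochastic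

variable {Ω : Type*} {x₀ : Ω → Fin nx → ℝ} {w : ℕ → Ω → Fin nw → ℝ} {δ : ℕ → Ω → Fin nd → ℝ}

/-- The σ-algebra is left arbitrary so that the result applies to the information σ-algebra at time
t, not only to the ambient one. -/
lemma measurable_stateHistory {m : MeasurableSpace Ω} (hκ : ∀ t, Measurable (κ t)) {t : ℕ}
    (hx : Measurable x₀) (hw : ∀ s < t, Measurable (w s)) (hδ : ∀ s < t, Measurable (δ s)) :
    Measurable fun ω => S.stateHistory κ (x₀ ω) (fun s => w s ω) (fun s => δ s ω) t := by
  induction t with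
  | zero => exact measurable_pi_iff.2 fun _ => hx
  | succ t ih =>
    have h := ih (fun s hs => hw s (hs.trans t.lt_succ_self))
      (fun s hs => hδ s (hs.trans t.lt_succ_self))
    refine measurable_pi_iff.2 fun i => ?_
    simp only [stateHistory]
    induction i using Fin.lastCases with
    | last =>
      simp only [Fin.snoc_last]
      exact (((((measurable_pi_apply _).comp h).matrix_mulVec _).add
        ((hw t t.lt_succ_self).matrix_mulVec _)).add
        ((hδ t t.lt_succ_self).matrix_mulVec _)).add (((hκ t).comp h).matrix_mulVec _)
    | cast i =>
      simp only [Fin.snoc_castSucc]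
      exact (measurable_pi_apply i).comp h

lemma measurable_infoSigma_stateHistory (hκ : ∀ t, Measurable (κ t)) {t : ℕ}
    (hδ : ∀ s < t, Measurable[infoSigma x₀ w (s + 1)] (δ s)) :
    Measurable[infoSigma x₀ w t]
      fun ω => S.stateHistory κ (x₀ ω) (fun s => w s ω) (fun s => δ s ω) t :=
  measurable_stateHistory hκ (measurable_infoSigma_x₀ t) (fun _ hs => measurable_infoSigma_w hs)
    fun s hs => (hδ s hs).mono (infoSigma_mono hs) le_rfl

lemma measurable_infoSigma_state (hκ : ∀ t, Measurable (κ t)) {t : ℕ}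
    (hδ : ∀ s < t, Measurable[infoSigma x₀ w (s + 1)] (δ s)) :
    Measurable[infoSigma x₀ w t]
      fun ω => S.state κ (x₀ ω) (fun s => w s ω) (fun s => δ s ω) t :=
  (measurable_pi_apply _).comp (measurable_infoSigma_stateHistory hκ hδ)

lemma measurable_infoSigma_input (hκ : ∀ t, Measurable (κ t)) {t : ℕ}
    (hδ : ∀ s < t, Measurable[infoSigma x₀ w (s + 1)] (δ s)) :
    Measurable[infoSigma x₀ w t]
      fun ω => S.input κ (x₀ ω) (fun s => w s ω) (fun s => δ s ω) t :=
  (hκ t).comp (measurable_infoSigma_stateHistory hκ hδ)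

/-- Causality of a perturbation that follows a measurable strategy. -/
lemma measurable_of_strategy (hκ : ∀ t, Measurable (κ t))
    {φ : (t : ℕ) → (Fin (t + 1) → Fin nx → ℝ) → (Fin nw → ℝ) → Fin nd → ℝ}
    (hφ : ∀ t, Measurable fun p : (Fin (t + 1) → Fin nx → ℝ) × (Fin nw → ℝ) => φ t p.1 p.2)
    (h : ∀ t ω, δ t ω
      = φ t (S.stateHistory κ (x₀ ω) (fun s => w s ω) (fun s => δ s ω) t) (w t ω)) (t : ℕ) :
    Measurable[infoSigma x₀ w (t + 1)] (δ t) := by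
  induction t using Nat.strong_induction_on with
  | _ t ih =>
    rw [funext (h t)]
    have h1 := (measurable_infoSigma_stateHistory (S := S) hκ ih).mono
      (infoSigma_mono t.le_succ) le_rfl
    have h2 : Measurable[infoSigma x₀ w (t + 1)] (w t) := measurable_infoSigma_w t.lt_succ_self
    exact (hφ t).comp (h1.prodMk h2)

lemma dotProduct_self_nonneg_real {n : Type*} [Fintype n] (v : n → ℝ) : 0 ≤ v ⬝ᵥ v := by
  simpa using dotProduct_star_self_nonneg v

lemma penalty_nonneg (γ : ℝ) (T : ℕ) (ω : Ω) :
    0 ≤ γ ^ 2 * ∑ t ∈ Finset.range T, δ t ω ⬝ᵥ δ t ω :=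
  mul_nonneg (sq_nonneg _) (Finset.sum_nonneg fun _ _ => dotProduct_self_nonneg_real _)

variable [MeasurableSpace Ω] {μ : Measure Ω}

lemma IsNoise.memLp_state (hn : IsNoise μ x₀ w) {t : ℕ} (hδ : ∀ s < t, MemLp (δ s) 2 μ)
    (hu : ∀ s < t, MemLp (fun ω => S.input κ (x₀ ω) (fun s => w s ω) (fun s => δ s ω) s) 2 μ) :
    MemLp (fun ω => S.state κ (x₀ ω) (fun s => w s ω) (fun s => δ s ω) t) 2 μ := by
  induction t with
  | zero => exact hn.memLp_x₀
  | succ t ih =>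
    have h := ih (fun s hs => hδ s (hs.trans t.lt_succ_self))
      (fun s hs => hu s (hs.trans t.lt_succ_self))
    have h1 := h.matrix_mulVec S.A
    have h2 := (hn.memLp_w t).matrix_mulVec S.B₀
    have h3 := (hδ t t.lt_succ_self).matrix_mulVec S.B₁
    have h4 := (hu t t.lt_succ_self).matrix_mulVec S.B₂
    simp only [state_succ]
    exact ((h1.add h2).add h3).add h4

lemma IsNoise.memLp_state_staticFeedback (hn : IsNoise μ x₀ w) (K : Matrix (Fin nu) (Fin nx) ℝ)
    {t : ℕ} (hδ : ∀ s < t, MemLp (δ s) 2 μ) :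
    MemLp (fun ω => S.state (staticFeedback K) (x₀ ω) (fun s => w s ω) (fun s => δ s ω) t) 2 μ := by
  induction t using Nat.strong_induction_on with
  | _ t ih =>
    exact hn.memLp_state hδ fun s hs =>
      (ih s hs fun r hr => hδ r (hr.trans hs)).matrix_mulVec K

/-! ### Expected payoff -/

/-- The expected stage payoff `E [‖z_t‖² - γ² ‖δ_t‖²]`. -/
def stagePayoff (S : LQSystem nx nw nd nu) (μ : Measure Ω) (x₀ : Ω → Fin nx → ℝ)
    (w : ℕ → Ω → Fin nw → ℝ) (γ : ℝ) (κ : Controller nx nu) (δ : ℕ → Ω → Fin nd → ℝ) (t : ℕ) : ℝ :=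
  ∫ ω, (quadForm S.Q (S.state κ (x₀ ω) (fun s => w s ω) (fun s => δ s ω) t)
    + quadForm S.R (S.input κ (x₀ ω) (fun s => w s ω) (fun s => δ s ω) t)
    - γ ^ 2 * (δ t ω ⬝ᵥ δ t ω)) ∂μ

lemma integrable_penalty (hδ : ∀ t, MemLp (δ t) 2 μ) (γ : ℝ) (T : ℕ) :
    Integrable (fun ω => γ ^ 2 * ∑ t ∈ Finset.range T, δ t ω ⬝ᵥ δ t ω) μ :=
  (integrable_finsetSum _ fun t _ => (hδ t).integrable_dotProduct (hδ t)).const_mul _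

/-- With finite second moments both extended integrals are finite, so their difference is an honest
real number and splits over the stages. -/
lemma expectedPayoff_eq_sum (hQ : S.Q.PosSemidef) (hR : S.R.PosDef) {γ : ℝ} {T : ℕ}
    (hδ : ∀ t, MemLp (δ t) 2 μ)
    (hx : ∀ t < T, MemLp (fun ω => S.state κ (x₀ ω) (fun s => w s ω) (fun s => δ s ω) t) 2 μ)
    (hu : ∀ t < T, MemLp (fun ω => S.input κ (x₀ ω) (fun s => w s ω) (fun s => δ s ω) t) 2 μ) :
    S.expectedPayoff μ x₀ w γ κ δ T
      = ((∑ t ∈ Finset.range T, S.stagePayoff μ x₀ w γ κ δ t : ℝ) : EReal) := by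
  have hint : ∀ t ∈ Finset.range T, Integrable (fun ω =>
      quadForm S.Q (S.state κ (x₀ ω) (fun s => w s ω) (fun s => δ s ω) t)
      + quadForm S.R (S.input κ (x₀ ω) (fun s => w s ω) (fun s => δ s ω) t)) μ := fun t ht =>
    ((hx t (Finset.mem_range.1 ht)).integrable_quadForm _).add
      ((hu t (Finset.mem_range.1 ht)).integrable_quadForm _)
  have hpen := integrable_penalty hδ γ T
  have hpos : ∀ ω, 0 ≤ ∑ t ∈ Finset.range T,
      (quadForm S.Q (S.state κ (x₀ ω) (fun s => w s ω) (fun s => δ s ω) t)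
      + quadForm S.R (S.input κ (x₀ ω) (fun s => w s ω) (fun s => δ s ω) t)) := fun ω =>
    Finset.sum_nonneg fun t _ =>
      add_nonneg (hQ.quadForm_nonneg _) (hR.posSemidef.quadForm_nonneg _)
  have hpos' : ∀ ω, 0 ≤ γ ^ 2 * ∑ t ∈ Finset.range T, δ t ω ⬝ᵥ δ t ω := penalty_nonneg γ T
  simp only [expectedPayoff, perf_sq hQ hR]
  rw [← ofReal_integral_eq_lintegral_ofReal (integrable_finsetSum _ hint)
(ae_of_all _ hpos),
    ← ofReal_integral_eq_lintegral_ofReal hpen (ae_of_all _ hpos'),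
    EReal.coe_ennreal_ofReal, EReal.coe_ennreal_ofReal, max_eq_left (integral_nonneg hpos),
    max_eq_left (integral_nonneg hpos'), ← EReal.coe_sub,
    ← integral_sub (integrable_finsetSum _ hint) hpen]
  congr 1
  simp only [stagePayoff]
  refine Eq.trans ?_ (integral_finsetSum _ fun t ht =>
    (hint t ht).sub (((hδ t).integrable_dotProduct (hδ t)).const_mul (γ ^ 2)))
  refine integral_congr_ae (ae_of_all _ fun ω => ?_)
  simp [Finset.sum_sub_distrib, Finset.mul_sum]

/-- An input without second moment costs infinitely much. -/
lemma expectedPayoff_eq_top (hR : S.R.PosDef) {γ : ℝ} {T n : ℕ} (hnT : n < T)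
    (hδ : ∀ t, MemLp (δ t) 2 μ)
    (hxm : ∀ t, Measurable fun ω => S.state κ (x₀ ω) (fun s => w s ω) (fun s => δ s ω) t)
    (hum : ∀ t, Measurable fun ω => S.input κ (x₀ ω) (fun s => w s ω) (fun s => δ s ω) t)
    (hu : ¬ MemLp (fun ω => S.input κ (x₀ ω) (fun s => w s ω) (fun s => δ s ω) n) 2 μ) :
    S.expectedPayoff μ x₀ w γ κ δ T = ⊤ := by
  have hzm : ∀ t, Measurable fun ω => S.perf κ (x₀ ω) (fun s => w s ω) (fun s => δ s ω) t :=
    fun t => ((hxm t).matrix_mulVec S.C₁).add ((hum t).matrix_mulVec S.D₁₂)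
  have htop : ∫⁻ ω, ENNReal.ofReal (∑ t ∈ Finset.range T,
      S.perf κ (x₀ ω) (fun s => w s ω) (fun s => δ s ω) t ⬝ᵥ
        S.perf κ (x₀ ω) (fun s => w s ω) (fun s => δ s ω) t) ∂μ = ⊤ := by
    by_contra hfin
    apply hu
    have hzz : ∀ t, Measurable fun ω => S.perf κ (x₀ ω) (fun s => w s ω) (fun s => δ s ω) t ⬝ᵥ
        S.perf κ (x₀ ω) (fun s => w s ω) (fun s => δ s ω) t := fun t =>
      Finset.measurable_sum _ fun i _ =>
        ((measurable_pi_apply i).comp (hzm t)).mul ((measurable_pi_apply i).comp (hzm t))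
    have hsum := Finset.measurable_sum (Finset.range T) fun t _ => hzz t
    have hint : Integrable (fun ω => ∑ t ∈ Finset.range T,
        S.perf κ (x₀ ω) (fun s => w s ω) (fun s => δ s ω) t ⬝ᵥ
          S.perf κ (x₀ ω) (fun s => w s ω) (fun s => δ s ω) t) μ :=
      (lintegral_ofReal_ne_top_iff_integrable hsum.aestronglyMeasurable
        (ae_of_all _ fun ω => Finset.sum_nonneg fun _ _ => dotProduct_self_nonneg_real _)).1 hfin
    have hz : MemLp (fun ω => S.perf κ (x₀ ω) (fun s => w s ω) (fun s => δ s ω) n) 2 μ := by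
      refine memLp_two_of_integrable_dotProduct_self (hzm n)
        (hint.mono' (hzz n).aestronglyMeasurable (ae_of_all _ fun ω => ?_))
      rw [Real.norm_of_nonneg (dotProduct_self_nonneg_real _)]
      exact Finset.single_le_sum (f := fun t =>
        S.perf κ (x₀ ω) (fun s => w s ω) (fun s => δ s ω) t ⬝ᵥ
          S.perf κ (x₀ ω) (fun s => w s ω) (fun s => δ s ω) t)
        (fun _ _ => dotProduct_self_nonneg_real _) (Finset.mem_range.2 hnT)
    have hsq := MemLp.of_eval (f := fun ω =>
      CFC.sqrt S.R *ᵥ S.input κ (x₀ ω) (fun s => w s ω) (fun s => δ s ω) n) fun j => by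
        have := hz.eval (Sum.inr j)
        simpa only [perf, C₁_mulVec_add_D₁₂_mulVec, Sum.elim_inr] using this
    -- R ≻ 0 allows u_n to be recovered linearly from R^{1/2}u_n, so a finite cost would give u_n a
    -- second moment.
    have hinv : S.R⁻¹ * CFC.sqrt S.R * CFC.sqrt S.R = 1 := by
      rw [Matrix.mul_assoc, CFC.sqrt_mul_sqrt_self S.R
        (Matrix.nonneg_iff_posSemidef.2 hR.posSemidef),
        Matrix.nonsing_inv_mul _ hR.isUnit_det_real]
    simpa only [mulVec_mulVec, hinv, one_mulVec] using hsq.matrix_mulVec (S.R⁻¹ * CFC.sqrt S.R)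
  rw [expectedPayoff, htop, ← ofReal_integral_eq_lintegral_ofReal (integrable_penalty hδ γ T)
    (ae_of_all _ fun ω => penalty_nonneg γ T ω), EReal.coe_ennreal_ofReal, EReal.coe_ennreal_top,
    EReal.top_sub_coe]

variable [IsProbabilityMeasure μ]

/-- The telescoped value identity along a backward Riccati recursion. -/
lemma sum_stagePayoff (hR : S.R.PosDef) (hn : IsNoise μ x₀ w) (hκ : ∀ t, Measurable (κ t)) {γ : ℝ}
    {T : ℕ} {V : ℕ → Matrix (Fin nx) (Fin nx) ℝ}
    (hV : ∀ t < T, S.IsAdmissible γ (V (t + 1)) ∧ S.riccati γ (V (t + 1)) = V t)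
    (hδ : IsCausalAdversary μ x₀ w δ)
    (hu : ∀ t < T, MemLp (fun ω => S.input κ (x₀ ω) (fun s => w s ω) (fun s => δ s ω) t) 2 μ) :
    ∑ t ∈ Finset.range T, S.stagePayoff μ x₀ w γ κ δ t
      + ∫ ω, quadForm (V T) (S.state κ (x₀ ω) (fun s => w s ω) (fun s => δ s ω) T) ∂μ
    = ∫ ω, quadForm (V 0) (x₀ ω) ∂μ
      + ∑ t ∈ Finset.range T, (
        ∫ ω, quadForm (S.inputWeight γ (V (t + 1)))
          (S.input κ (x₀ ω) (fun s => w s ω) (fun s => δ s ω) t - S.inputGain γ (V (t + 1)) *ᵥ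
            S.state κ (x₀ ω) (fun s => w s ω) (fun s => δ s ω) t) ∂μ
        + (S.gameM γ (V (t + 1)) * (S.B₀ * S.B₀ᵀ)).trace
        - ∫ ω, quadForm (S.advWeight γ (V (t + 1))) (δ t ω - S.advGain γ (V (t + 1)) *ᵥ
            (S.A *ᵥ S.state κ (x₀ ω) (fun s => w s ω) (fun s => δ s ω) t
              + S.B₂ *ᵥ S.input κ (x₀ ω) (fun s => w s ω) (fun s => δ s ω) t
              + S.B₀ *ᵥ w t ω)) ∂μ) := by
  induction T with
  | zero => simp [state_zero]
  | succ T ih =>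
    have hm : ∀ s < T, Measurable[infoSigma x₀ w (s + 1)] (δ s) := fun s _ => (hδ s).1
    have hxT := hn.memLp_state (S := S) (κ := κ) (δ := δ) (t := T) (fun s _ => (hδ s).2)
      fun s hs => hu s (hs.trans T.lt_succ_self)
    have e := (hV T T.lt_succ_self).1.integral_step hR hn (measurable_infoSigma_state hκ hm)
      (measurable_infoSigma_input hκ hm) hxT (hu T T.lt_succ_self) (hδ T).2
    have e' := ih (fun t ht => hV t (ht.trans T.lt_succ_self))
      (fun t ht => hu t (ht.trans T.lt_succ_self))
    rw [(hV T T.lt_succ_self).2] at e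
    rw [Finset.sum_range_succ, Finset.sum_range_succ]
    simp only [state_succ]
    rw [stagePayoff]
    linarith

end Stochastic

end LQSystem

/-- The bound K ≥ 1 serves the contraction estimate in `exists_integral_quadForm_le`, where K − 1
must be nonnegative. -/
lemma exists_quadForm_le {n : Type*} [Fintype n] (P : Matrix n n ℝ) :
    ∃ K : ℝ, 1 ≤ K ∧ ∀ x, quadForm P x ≤ K * (x ⬝ᵥ x) := by
  refine ⟨1 + ∑ i, ∑ j, |P i j|, ?_, fun x => ?_⟩
  · have : 0 ≤ ∑ i, ∑ j, |P i j| :=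
      Finset.sum_nonneg fun i _ => Finset.sum_nonneg fun j _ => abs_nonneg _
    linarith
  · have hx : 0 ≤ x ⬝ᵥ x := Finset.sum_nonneg fun i _ => mul_self_nonneg _
    have hi : ∀ i, x i * x i ≤ x ⬝ᵥ x := fun i =>
      Finset.single_le_sum (f := fun i => x i * x i) (fun i _ => mul_self_nonneg _)
        (Finset.mem_univ i)
    have h : quadForm P x ≤ (∑ i, ∑ j, |P i j|) * (x ⬝ᵥ x) := by
      have e : quadForm P x = ∑ i, ∑ j, x i * (P i j * x j) :=
        Finset.sum_congr rfl fun i _ => Finset.mul_sum _ _ _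
      rw [e, Finset.sum_mul]
      refine Finset.sum_le_sum fun i _ => ?_
      rw [Finset.sum_mul]
      refine Finset.sum_le_sum fun j _ => ?_
      calc x i * (P i j * x j) ≤ |x i * (P i j * x j)| := le_abs_self _
        _ = |P i j| * |x i * x j| := by rw [← abs_mul]; congr 1; ring
        _ ≤ |P i j| * (x ⬝ᵥ x) := by
          refine mul_le_mul_of_nonneg_left ?_ (abs_nonneg _)
          rw [abs_le]
          constructor <;> nlinarith [hi i, hi j, sq_nonneg (x i + x j), sq_nonneg (x i - x j)]
    linarith

/-! ### Long-run averages -/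

section Averages

open scoped Topology

variable {X : ℕ → EReal} {a : ℕ → ℝ} {τ : ℝ}

lemma limsup_average_le (hX : ∀ T, X T ≤ (a T : EReal))
    (ha : Tendsto (fun T : ℕ => (T : ℝ)⁻¹ * a T) atTop (𝓝 τ)) :
    limsup (fun T : ℕ => (((T : ℝ)⁻¹ : ℝ) : EReal) * X T) atTop ≤ (τ : EReal) := by
  rw [← ((continuous_coe_real_ereal.tendsto τ).comp ha).limsup_eq]
  refine limsup_le_limsup (Eventually.of_forall fun T => ?_)
  simp only [Function.comp, EReal.coe_mul]
  exact mul_le_mul_of_nonneg_left (hX T) (by exact_mod_cast inv_nonneg.2 T.cast_nonneg)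

lemma le_limsup_average (hX : ∀ T, (a T : EReal) ≤ X T)
    (ha : Tendsto (fun T : ℕ => (T : ℝ)⁻¹ * a T) atTop (𝓝 τ)) :
    (τ : EReal) ≤ limsup (fun T : ℕ => (((T : ℝ)⁻¹ : ℝ) : EReal) * X T) atTop := by
  rw [← ((continuous_coe_real_ereal.tendsto τ).comp ha).limsup_eq]
  refine limsup_le_limsup (Eventually.of_forall fun T => ?_)
  simp only [Function.comp, EReal.coe_mul]
  exact mul_le_mul_of_nonneg_left (hX T) (by exact_mod_cast inv_nonneg.2 T.cast_nonneg)

lemma tendsto_average_affine (c τ : ℝ) :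
    Tendsto (fun T : ℕ => (T : ℝ)⁻¹ * (c + T * τ)) atTop (𝓝 τ) := by
  have h : Tendsto (fun T : ℕ => (T : ℝ)⁻¹ * c + τ) atTop (𝓝 (0 * c + τ)) :=
    (tendsto_inv_atTop_nhds_zero_nat.mul_const c).add_const τ
  rw [zero_mul, zero_add] at h
  refine h.congr' ?_
  filter_upwards [eventually_gt_atTop 0] with T hT
  field_simp

end Averages

namespace LQSystem

open scoped Topology

variable {nx nw nd nu : ℕ} {S : LQSystem nx nw nd nu} {κ : Controller nx nu}
  {Ω : Type*} [MeasurableSpace Ω] {μ : Measure Ω}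
  {x₀ : Ω → Fin nx → ℝ} {w : ℕ → Ω → Fin nw → ℝ} {δ : ℕ → Ω → Fin nd → ℝ} {γ : ℝ}

/-! ### Linear feedback -/

lemma measurable_staticFeedback (K : Matrix (Fin nu) (Fin nx) ℝ) (t : ℕ) :
    Measurable (staticFeedback K t) :=
  (measurable_pi_apply (Fin.last t)).matrix_mulVec K

/-- The linear feedback perturbation exists and is causal. -/
lemma IsNoise.exists_feedback_perturbation (hn : IsNoise μ x₀ w) (K : Matrix (Fin nu) (Fin nx) ℝ)
    (E : Matrix (Fin nd) (Fin nx) ℝ) (D : Matrix (Fin nd) (Fin nw) ℝ) :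
    ∃ δ : ℕ → Ω → Fin nd → ℝ, IsCausalAdversary μ x₀ w δ ∧ ∀ t ω, δ t ω
      = E *ᵥ S.state (staticFeedback K) (x₀ ω) (fun s => w s ω) (fun s => δ s ω) t
        + D *ᵥ w t ω := by
  let φ : (t : ℕ) → (Fin (t + 1) → Fin nx → ℝ) → (Fin nw → ℝ) → Fin nd → ℝ := fun t h v =>
    E *ᵥ h (Fin.last t) + D *ᵥ v
  have hφ : ∀ t, Measurable fun p : (Fin (t + 1) → Fin nx → ℝ) × (Fin nw → ℝ) =>
      φ t p.1 p.2 := fun t =>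
    (((measurable_pi_apply (Fin.last t)).comp measurable_fst).matrix_mulVec E).add
      (measurable_snd.matrix_mulVec D)
  choose f hf using fun ω =>
    exists_perturbation_of_strategy S (staticFeedback K) φ (x₀ ω) fun s => w s ω
  have hd : ∀ t ω, f ω t = E *ᵥ S.state (staticFeedback K) (x₀ ω) (fun s => w s ω)
      (fun s => f ω s) t + D *ᵥ w t ω := fun t ω => hf ω t
  refine ⟨fun t ω => f ω t, fun t => ⟨measurable_of_strategy (S := S)
    (measurable_staticFeedback K) hφ (fun t ω => hf ω t) t, ?_⟩, hd⟩
  induction t using Nat.strong_induction_on with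
  | _ t ih =>
    have h1 := (hn.memLp_state_staticFeedback (S := S) K (δ := fun t ω => f ω t) ih).matrix_mulVec E
    have h2 := (hn.memLp_w t).matrix_mulVec D
    simp only [hd t]
    exact h1.add h2

variable [IsProbabilityMeasure μ]

/-! ### Lower bound for an arbitrary controller -/

/-- The adversary plays optimally for the horizon T, reacting to the realized input and noise with
the gain for the remaining T − t − 1 stages. All adversarial remainders vanish, and the input
remainders and the initial value only help. If the controller produces an input without second
moment, its cost is infinite and the bound is trivial. -/
lemma le_iSup_expectedPayoff (hQ : S.Q.PosSemidef) (hR : S.R.PosDef)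
    (hex : ∃ P, S.IsGameSolution γ P) (hn : IsNoise μ x₀ w) (hκ : ∀ t, Measurable (κ t)) (T : ℕ) :
    ((∑ k ∈ Finset.range T, (S.gameM γ (S.valueIter γ k) * (S.B₀ * S.B₀ᵀ)).trace : ℝ) : EReal)
      ≤ ⨆ (δ : ℕ → Ω → Fin nd → ℝ) (_ : IsCausalAdversary μ x₀ w δ),
        S.expectedPayoff μ x₀ w γ κ δ T := by
  obtain ⟨P, hP⟩ := hex
  let G : ℕ → Matrix (Fin nd) (Fin nx) ℝ := fun t => S.advGain γ (S.valueIter γ (T - (t + 1)))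
  let φ : (t : ℕ) → (Fin (t + 1) → Fin nx → ℝ) → (Fin nw → ℝ) → Fin nd → ℝ := fun t h v =>
    G t *ᵥ (S.A *ᵥ h (Fin.last t) + S.B₂ *ᵥ κ t h + S.B₀ *ᵥ v)
  have hφ : ∀ t, Measurable fun p : (Fin (t + 1) → Fin nx → ℝ) × (Fin nw → ℝ) =>
      φ t p.1 p.2 := fun t =>
    ((((((measurable_pi_apply (Fin.last t)).comp measurable_fst).matrix_mulVec S.A).add
      (((hκ t).comp measurable_fst).matrix_mulVec S.B₂)).add
      (measurable_snd.matrix_mulVec S.B₀))).matrix_mulVec (G t)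
  choose f hf using fun ω => exists_perturbation_of_strategy S κ φ (x₀ ω) fun s => w s ω
  let d : ℕ → Ω → Fin nd → ℝ := fun t ω => f ω t
  have hd : ∀ t ω, d t ω
      = φ t (S.stateHistory κ (x₀ ω) (fun s => w s ω) (fun s => d s ω) t) (w t ω) :=
    fun t ω => hf ω t
  have hdm : ∀ t, Measurable[infoSigma x₀ w (t + 1)] (d t) := measurable_of_strategy hκ hφ hd
  let U : ℕ → Ω → Fin nu → ℝ := fun t ω =>
    S.input κ (x₀ ω) (fun s => w s ω) (fun s => d s ω) t
  -- Admissible perturbations need second moments at all times, including after the controller may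
  -- have left L². Stopping the strategy at time n guarantees this when the inputs before n are
  -- square-integrable.
  let dn : ℕ → ℕ → Ω → Fin nd → ℝ := fun n t => if t < n then d t else 0
  have hdn : ∀ n, ∀ t < n, dn n t = d t := fun n t ht => if_pos ht
  have hhist : ∀ n, ∀ t ≤ n, ∀ ω,
      S.stateHistory κ (x₀ ω) (fun s => w s ω) (fun s => dn n s ω) t
        = S.stateHistory κ (x₀ ω) (fun s => w s ω) (fun s => d s ω) t := fun n t ht ω =>
    stateHistory_congr fun s hs => by simp only [hdn n s (hs.trans_le ht)]
  have hinput : ∀ n, ∀ t ≤ n,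
      (fun ω => S.input κ (x₀ ω) (fun s => w s ω) (fun s => dn n s ω) t) = U t :=
    fun n t ht => funext fun ω => by
      simp only [input, hhist n t ht, U]
  have hL2 : ∀ n, (∀ t < n, MemLp (U t) 2 μ) → ∀ t < n, MemLp (d t) 2 μ := by
    intro n hU t
    induction t using Nat.strong_induction_on with
    | _ t ih =>
      intro htn
      have hx := hn.memLp_state (S := S) (κ := κ) (δ := d) (t := t)
        (fun s hs => ih s hs (hs.trans htn)) fun s hs => hU s (hs.trans htn)
      have h1 := (((hx.matrix_mulVec S.A).add ((hU t htn).matrix_mulVec S.B₂)).add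
        ((hn.memLp_w t).matrix_mulVec S.B₀)).matrix_mulVec (G t)
      rw [funext (hd t)]
      exact h1
  have hcausal : ∀ n, (∀ t < n, MemLp (U t) 2 μ) → IsCausalAdversary μ x₀ w (dn n) := by
    intro n hU t
    by_cases ht : t < n
    · rw [hdn n t ht]
      exact ⟨hdm t, hL2 n hU t ht⟩
    · have h0 : dn n t = 0 := if_neg ht
      rw [h0]
      exact ⟨measurable_const, MemLp.zero⟩
  by_cases hU : ∀ t < T, MemLp (U t) 2 μ
  · have hc := hcausal T hU
    refine le_trans ?_ (le_iSup₂ (f := fun δ (_ : IsCausalAdversary μ x₀ w δ) =>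
      S.expectedPayoff μ x₀ w γ κ δ T) (dn T) hc)
    have hu : ∀ t < T, MemLp (fun ω =>
        S.input κ (x₀ ω) (fun s => w s ω) (fun s => dn T s ω) t) 2 μ := fun t ht => by
      rw [hinput T t ht.le]
      exact hU t ht
    rw [expectedPayoff_eq_sum hQ hR (fun t => (hc t).2) (fun t ht =>
      hn.memLp_state (fun s _ => (hc s).2) fun s hs => hu s (hs.trans ht)) hu, EReal.coe_le_coe_iff]
    -- The backward recursion starts from terminal value V_T = 0, and V_t is the value with T − t
    -- stages to go.
    have e := sum_stagePayoff (γ := γ) (V := fun t => S.valueIter γ (T - t)) hR hn hκ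
      (fun t ht => ⟨(valueIter_le hQ hR hP _).1, by
        rw [← valueIter_succ]; congr 1; omega⟩) hc hu
    -- Reverse time: the trace at stage t is that of iterate T − 1 − t.
    rw [← Finset.sum_range_reflect]
    have e0 : ∫ ω, quadForm (S.valueIter γ (T - T))
        (S.state κ (x₀ ω) (fun s => w s ω) (fun s => dn T s ω) T) ∂μ = 0 := by
      simp [valueIter_zero, quadForm]
    have e1 : 0 ≤ ∫ ω, quadForm (S.valueIter γ (T - 0)) (x₀ ω) ∂μ :=
      integral_nonneg fun ω => (valueIter_le hQ hR hP _).1.1.quadForm_nonneg _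
    rw [e0, add_zero] at e
    rw [e]
    refine le_add_of_nonneg_of_le e1 (Finset.sum_le_sum fun t ht => ?_)
    have ht' := Finset.mem_range.1 ht
    have e2 : ∫ ω, quadForm (S.advWeight γ (S.valueIter γ (T - (t + 1))))
        (dn T t ω - S.advGain γ (S.valueIter γ (T - (t + 1))) *ᵥ
            (S.A *ᵥ S.state κ (x₀ ω) (fun s => w s ω) (fun s => dn T s ω) t
              + S.B₂ *ᵥ S.input κ (x₀ ω) (fun s => w s ω) (fun s => dn T s ω) t
              + S.B₀ *ᵥ w t ω)) ∂μ = 0 := by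
      refine integral_eq_zero_of_ae (ae_of_all _ fun ω => ?_)
      simp only [state, input, hhist T t ht'.le, hdn T t ht']
      rw [hd t ω, sub_self, quadForm_zero]
      rfl
    rw [e2, sub_zero]
    have e3 : T - 1 - t = T - (t + 1) := by omega
    rw [e3]
    exact le_add_of_nonneg_left (integral_nonneg fun ω =>
      ((valueIter_le hQ hR hP _).1.inputWeight_posDef hR).posSemidef.quadForm_nonneg _)
  · have hU' : ∃ n, n < T ∧ ¬ MemLp (U n) 2 μ := by
      push Not at hU
      exact hU
    classical
    obtain ⟨hnT, hnU⟩ := Nat.find_spec hU'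
    -- At the first time n without second moment, all earlier inputs are in L². Stopping the
    -- strategy at n is therefore admissible and does not alter the input at n, so the payoff is
    -- infinite.
    set n := Nat.find hU' with hn_def
    have hlt : ∀ t < n, MemLp (U t) 2 μ := fun t ht => by
      have := Nat.find_min hU' ht
      by_contra h
      exact this ⟨ht.trans hnT, h⟩
    have hc := hcausal n hlt
    refine le_trans ?_ (le_iSup₂ (f := fun δ (_ : IsCausalAdversary μ x₀ w δ) =>
      S.expectedPayoff μ x₀ w γ κ δ T) (dn n) hc)
    rw [expectedPayoff_eq_top hR hnT (fun t => (hc t).2)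
      (fun t => (measurable_infoSigma_state hκ fun s _ => (hc s).1).mono (hn.infoSigma_le t) le_rfl)
      (fun t => (measurable_infoSigma_input hκ fun s _ => (hc s).1).mono (hn.infoSigma_le t) le_rfl)
      (by rw [hinput n n le_rfl]; exact hnU)]
    exact le_top

/-- M is continuous at the limit of value iteration, so the traces converge and their Cesàro means
have the same limit. -/
lemma trace_le_softObjective (hQ : S.Q.PosSemidef) (hR : S.R.PosDef) {P : Matrix (Fin nx) (Fin nx) ℝ}
    (hP : S.IsGameSolution γ P) (hlim : Tendsto (S.valueIter γ) atTop (𝓝 P))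
    (hn : IsNoise μ x₀ w) (hκ : ∀ t, Measurable (κ t)) :
    (((S.gameM γ P * (S.B₀ * S.B₀ᵀ)).trace : ℝ) : EReal) ≤ S.softObjective μ x₀ w γ κ := by
  refine le_limsup_average (le_iSup_expectedPayoff hQ hR ⟨P, hP⟩ hn hκ) ?_
  refine Filter.Tendsto.cesaro ?_
  have hM := ((isGameSolution_iff hR).1 hP).1.tendsto_gameM hlim
  exact ((continuous_id.matrix_trace).tendsto _).comp (hM.matrix_mul tendsto_const_nhds)

/-! ### The static controller -/

variable {P : Matrix (Fin nx) (Fin nx) ℝ}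

/-- Payoff of the controller gain against an arbitrary causal perturbation. -/
lemma expectedPayoff_gainF (hQ : S.Q.PosSemidef) (hR : S.R.PosDef) (hP : S.IsGameSolution γ P)
    (hn : IsNoise μ x₀ w) (hδ : IsCausalAdversary μ x₀ w δ) (T : ℕ) :
    S.expectedPayoff μ x₀ w γ (staticFeedback (S.gainF γ P)) δ T
      = ((∫ ω, quadForm P (x₀ ω) ∂μ + T * (S.gameM γ P * (S.B₀ * S.B₀ᵀ)).trace
        - ∫ ω, quadForm P (S.state (staticFeedback (S.gainF γ P)) (x₀ ω) (fun s => w s ω)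
            (fun s => δ s ω) T) ∂μ
        - ∑ t ∈ Finset.range T, ∫ ω, quadForm (S.advWeight γ P) (δ t ω - (S.gainE γ P *ᵥ
            S.state (staticFeedback (S.gainF γ P)) (x₀ ω) (fun s => w s ω) (fun s => δ s ω) t
              + S.gainDelta γ P *ᵥ w t ω)) ∂μ : ℝ) : EReal) := by
  obtain ⟨hadm, hric⟩ := (isGameSolution_iff hR).1 hP
  have hx : ∀ t, MemLp (fun ω => S.state (staticFeedback (S.gainF γ P)) (x₀ ω) (fun s => w s ω)
      (fun s => δ s ω) t) 2 μ := fun t =>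
    hn.memLp_state_staticFeedback _ fun s _ => (hδ s).2
  have hu : ∀ t, MemLp (fun ω => S.input (staticFeedback (S.gainF γ P)) (x₀ ω) (fun s => w s ω)
      (fun s => δ s ω) t) 2 μ := fun t => (hx t).matrix_mulVec _
  rw [expectedPayoff_eq_sum hQ hR (fun t => (hδ t).2) (fun t _ => hx t) fun t _ => hu t]
  congr 1
  -- A Riccati solution is a stationary value: the recursion is constant in t, and u = Fx
  -- annihilates the input remainder.
  have e := sum_stagePayoff (T := T) (γ := γ) (V := fun _ => P) hR hn
    (measurable_staticFeedback (S.gainF γ P)) (fun _ _ => ⟨hadm, hric⟩) hδ fun t _ => hu t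
  have hin : ∀ t ω, S.input (staticFeedback (S.gainF γ P)) (x₀ ω) (fun s => w s ω)
      (fun s => δ s ω) t = S.inputGain γ P *ᵥ S.state (staticFeedback (S.gainF γ P)) (x₀ ω)
        (fun s => w s ω) (fun s => δ s ω) t := fun t ω => by
    rw [← hadm.gainF_eq hR]
    rfl
  have hgain : ∀ (x : Fin nx → ℝ) (v : Fin nw → ℝ),
      S.advGain γ P *ᵥ (S.A *ᵥ x + S.B₂ *ᵥ S.inputGain γ P *ᵥ x + S.B₀ *ᵥ v)
        = S.gainE γ P *ᵥ x + S.gainDelta γ P *ᵥ v := fun x v => by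
    have hD : S.gainDelta γ P = S.advGain γ P * S.B₀ := by
      simp only [gainDelta, advGain, advWeight, Matrix.mul_assoc]
    rw [hadm.gainE_eq hR, hD, mulVec_add, mulVec_mulVec x, ← add_mulVec, mulVec_mulVec,
      mulVec_mulVec]
  simp only [hin, sub_self, quadForm_zero, integral_zero, zero_add, hgain,
    Finset.sum_sub_distrib, Finset.sum_const, Finset.card_range, nsmul_eq_mul] at e
  linarith

lemma expectedPayoff_gainF_le (hQ : S.Q.PosSemidef) (hR : S.R.PosDef)
    (hP : S.IsGameSolution γ P) (hn : IsNoise μ x₀ w) (hδ : IsCausalAdversary μ x₀ w δ) (T : ℕ) :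
    S.expectedPayoff μ x₀ w γ (staticFeedback (S.gainF γ P)) δ T
      ≤ ((∫ ω, quadForm P (x₀ ω) ∂μ + T * (S.gameM γ P * (S.B₀ * S.B₀ᵀ)).trace : ℝ) : EReal) := by
  obtain ⟨hadm, -⟩ := (isGameSolution_iff hR).1 hP
  rw [expectedPayoff_gainF hQ hR hP hn hδ, EReal.coe_le_coe_iff, sub_sub]
  refine sub_le_self _ (add_nonneg (integral_nonneg fun ω => hadm.1.quadForm_nonneg _) ?_)
  exact Finset.sum_nonneg fun t _ => integral_nonneg fun ω => hadm.2.posSemidef.quadForm_nonneg _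

lemma softObjective_gainF_le (hQ : S.Q.PosSemidef) (hR : S.R.PosDef)
    (hP : S.IsGameSolution γ P) (hn : IsNoise μ x₀ w) :
    S.softObjective μ x₀ w γ (staticFeedback (S.gainF γ P))
      ≤ (((S.gameM γ P * (S.B₀ * S.B₀ᵀ)).trace : ℝ) : EReal) :=
  limsup_average_le (fun T => iSup₂_le fun _ hδ => expectedPayoff_gainF_le hQ hR hP hn hδ T)
    (tendsto_average_affine _ _)

lemma averagePayoff_gainF_le (hQ : S.Q.PosSemidef) (hR : S.R.PosDef)
    (hP : S.IsGameSolution γ P) (hn : IsNoise μ x₀ w) (hδ : IsCausalAdversary μ x₀ w δ) :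
    S.averagePayoff μ x₀ w γ (staticFeedback (S.gainF γ P)) δ
      ≤ (((S.gameM γ P * (S.B₀ * S.B₀ᵀ)).trace : ℝ) : EReal) :=
  limsup_average_le (fun T => expectedPayoff_gainF_le hQ hR hP hn hδ T)
    (tendsto_average_affine _ _)

/-! ### The worst-case perturbation -/

/-- A stable linear recursion driven by the noise has bounded second moments. -/
lemma IsNoise.exists_integral_quadForm_le (hn : IsNoise μ x₀ w) {Φ : Matrix (Fin nx) (Fin nx) ℝ}
    (hΦ : IsSchurStable Φ) {C : Matrix (Fin nx) (Fin nw) ℝ} {x : ℕ → Ω → Fin nx → ℝ}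
    (hxm : ∀ t, Measurable[infoSigma x₀ w t] (x t)) (hx : ∀ t, MemLp (x t) 2 μ)
    (hrec : ∀ t ω, x (t + 1) ω = Φ *ᵥ x t ω + C *ᵥ w t ω) (P : Matrix (Fin nx) (Fin nx) ℝ) :
    ∃ b : ℝ, ∀ t, ∫ ω, quadForm P (x t ω) ∂μ ≤ b := by
  obtain ⟨X, hX, hXeq⟩ := hΦ.exists_lyapunov
  obtain ⟨K, hK1, hK⟩ := exists_quadForm_le X
  obtain ⟨L, hL1, hL⟩ := exists_quadForm_le P
  have hXq : ∀ v, quadForm X v = v ⬝ᵥ v + quadForm X (Φ *ᵥ v) := fun v => by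
    conv_lhs => rw [hXeq]
    rw [quadForm_matrix_add, quadForm_one, quadForm_mulVec]
  set c := (X * (C * Cᵀ)).trace with hc
  set a : ℕ → ℝ := fun t => ∫ ω, quadForm X (x t ω) ∂μ with ha
  set e : ℕ → ℝ := fun t => ∫ ω, x t ω ⬝ᵥ x t ω ∂μ with he
  -- The Lyapunov equation X = I + ΦᵀXΦ says that the X-energy loses E‖x_t‖² at each step and gains
  -- the constant noise power c.
  have hstep : ∀ t, a (t + 1) = a t - e t + c := fun t => by
    have h1 : a (t + 1) = ∫ ω, quadForm X (Φ *ᵥ x t ω) ∂μ + c := by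
      simp only [ha, hrec]
      exact integral_quadForm_add_noise ((hx t).matrix_mulVec Φ) (hn.memLp_w t)
        (hn.indepFun_w ((hxm t).matrix_mulVec Φ)) (hn.mean_w t) (hn.cov_w t) hX.transpose_eq C
    have h2 : a t = e t + ∫ ω, quadForm X (Φ *ᵥ x t ω) ∂μ := by
      rw [he, ← integral_add ((hx t).integrable_dotProduct (hx t))
        (((hx t).matrix_mulVec Φ).integrable_quadForm X)]
      exact integral_congr_ae (ae_of_all _ fun ω => hXq _)
    linarith
  have hae : ∀ t, a t ≤ K * e t := fun t => by
    rw [he, ← integral_const_mul]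
    exact integral_mono ((hx t).integrable_quadForm X)
      (((hx t).integrable_dotProduct (hx t)).const_mul K) fun ω => hK _
  have hea : ∀ t, e t ≤ a t := fun t =>
    integral_mono ((hx t).integrable_dotProduct (hx t)) ((hx t).integrable_quadForm X) fun ω => by
      have := hX.quadForm_nonneg (Φ *ᵥ x t ω)
      have := hXq (x t ω)
      simp only
      linarith
  -- Since a ≤ K e, the recursion gives K a_{t+1} ≤ (K − 1) a_t + K c, which preserves every bound m
  -- ≥ K c.
  have hbd : ∀ t, a t ≤ max (a 0) (K * c) := fun t => by
    induction t with
    | zero => exact le_max_left _ _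
    | succ t ih =>
      have hm := le_max_right (a 0) (K * c)
      set m := max (a 0) (K * c)
      have hs := hstep t
      have h1 := hae t
      have hK0 : 0 < K := by linarith
      refine le_of_mul_le_mul_left (a := K) ?_ hK0
      rw [hs]
      nlinarith [mul_le_mul_of_nonneg_left ih (sub_nonneg.2 hK1)]
  refine ⟨L * max (a 0) (K * c), fun t => ?_⟩
  have h1 : ∫ ω, quadForm P (x t ω) ∂μ ≤ L * e t := by
    rw [he, ← integral_const_mul]
    exact integral_mono ((hx t).integrable_quadForm P)
      (((hx t).integrable_dotProduct (hx t)).const_mul L) fun ω => hL _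
  exact h1.trans (mul_le_mul_of_nonneg_left ((hea t).trans (hbd t)) (by linarith))

/-- The feedback makes every adversarial remainder zero, so only the terminal term E[x_TᵀPx_T]
separates the payoff from the upper bound. Stability of the fully perturbed loop bounds it uniformly
in T, and the average removes it. -/
lemma trace_le_averagePayoff (hQ : S.Q.PosSemidef) (hR : S.R.PosDef)
    (hP : S.IsGameSolution γ P) (hn : IsNoise μ x₀ w)
    (hstab : IsSchurStable (S.A + S.B₁ * S.gainE γ P + S.B₂ * S.gainF γ P))
    (hδ : IsCausalAdversary μ x₀ w δ)
    (hfb : ∀ t ω, δ t ω = S.gainE γ P *ᵥ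
      S.state (staticFeedback (S.gainF γ P)) (x₀ ω) (fun s => w s ω) (fun s => δ s ω) t
        + S.gainDelta γ P *ᵥ w t ω) :
    (((S.gameM γ P * (S.B₀ * S.B₀ᵀ)).trace : ℝ) : EReal)
      ≤ S.averagePayoff μ x₀ w γ (staticFeedback (S.gainF γ P)) δ := by
  obtain ⟨b, hb⟩ := hn.exists_integral_quadForm_le hstab (C := S.B₀ + S.B₁ * S.gainDelta γ P)
    (x := fun t ω => S.state (staticFeedback (S.gainF γ P)) (x₀ ω) (fun s => w s ω)
      (fun s => δ s ω) t)
    (fun t => measurable_infoSigma_state (measurable_staticFeedback _) fun s _ => (hδ s).1)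
    (fun t => hn.memLp_state_staticFeedback _ fun s _ => (hδ s).2)
    (fun t ω => by
      rw [state_succ, hfb t ω]
      have : S.input (staticFeedback (S.gainF γ P)) (x₀ ω) (fun s => w s ω) (fun s => δ s ω) t
        = S.gainF γ P *ᵥ S.state (staticFeedback (S.gainF γ P)) (x₀ ω) (fun s => w s ω)
          (fun s => δ s ω) t := rfl
      rw [this]
      simp only [add_mulVec, mulVec_add, ← mulVec_mulVec]
      abel) P
  refine le_limsup_average (a := fun T => (∫ ω, quadForm P (x₀ ω) ∂μ - b)
    + T * (S.gameM γ P * (S.B₀ * S.B₀ᵀ)).trace) (fun T => ?_) (tendsto_average_affine _ _)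
  rw [expectedPayoff_gainF hQ hR hP hn hδ, EReal.coe_le_coe_iff]
  have h0 : ∀ t ω, δ t ω - (S.gainE γ P *ᵥ
      S.state (staticFeedback (S.gainF γ P)) (x₀ ω) (fun s => w s ω) (fun s => δ s ω) t
        + S.gainDelta γ P *ᵥ w t ω) = 0 := fun t ω => sub_eq_zero.2 (hfb t ω)
  simp only [h0, quadForm_zero, integral_zero, Finset.sum_const_zero]
  have := hb T
  linarith

end LQSystem

end

theorem mainTheorem2 {nx nw nd nu : ℕ} (S : LQSystem nx nw nd nu) (γ : ℝ)
    (hQ : S.Q.PosSemidef) (hR : S.R.PosDef) (hdet : IsDetectable S.A (CFC.sqrt S.Q))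
    {Ω : Type*} [MeasurableSpace Ω] (μ : Measure Ω) [IsProbabilityMeasure μ]
    (x₀ : Ω → Fin nx → ℝ) (w : ℕ → Ω → Fin nw → ℝ) (hnoise : LQSystem.IsNoise μ x₀ w)
    (hex : ∃ P, S.IsGameSolution γ P) :
    -- every admissible Riccati solution gives a stabilizing gain
    (∀ P, S.IsGameSolution γ P → IsSchurStable (S.A + S.B₂ * S.gainF γ P)) ∧
    -- the least admissible solution exists
    ∃ P, S.IsLeastGameSolution γ P ∧
      -- its gain minimizes the objective over all causal state-feedback controllers
      (∀ κ : LQSystem.Controller nx nu, (∀ t, Measurable (κ t)) →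
        S.softObjective μ x₀ w γ (LQSystem.staticFeedback (S.gainF γ P))
          ≤ S.softObjective μ x₀ w γ κ) ∧
      -- the optimal value
      S.softObjective μ x₀ w γ (LQSystem.staticFeedback (S.gainF γ P))
        = (((S.gameM γ P * (S.B₀ * S.B₀ᵀ)).trace : ℝ) : EReal) ∧
      -- the optimal adversary, and the value achieved by the controller and this adversary
      (IsSchurStable (S.A + S.B₁ * S.gainE γ P + S.B₂ * S.gainF γ P) →
        ∃ δ : ℕ → Ω → Fin nd → ℝ, LQSystem.IsCausalAdversary μ x₀ w δ ∧
          (∀ t ω, δ t ω = S.gainE γ P *ᵥ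
              S.state (LQSystem.staticFeedback (S.gainF γ P)) (x₀ ω) (fun s => w s ω)
                (fun s => δ s ω) t
            + S.gainDelta γ P *ᵥ w t ω) ∧
          (∀ δ', LQSystem.IsCausalAdversary μ x₀ w δ' →
            S.averagePayoff μ x₀ w γ (LQSystem.staticFeedback (S.gainF γ P)) δ'
              ≤ S.averagePayoff μ x₀ w γ (LQSystem.staticFeedback (S.gainF γ P)) δ) ∧
          S.averagePayoff μ x₀ w γ (LQSystem.staticFeedback (S.gainF γ P)) δ
            = (((S.gameM γ P * (S.B₀ * S.B₀ᵀ)).trace : ℝ) : EReal)) := by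
  obtain ⟨P, hP, hlim⟩ := LQSystem.exists_isLeastGameSolution hQ hR hex
  -- The upper bound holds for any solution; the matching lower bound uses that P is the limit of
  -- value iteration.
  have hval := le_antisymm (LQSystem.softObjective_gainF_le hQ hR hP.1 hnoise)
    (LQSystem.trace_le_softObjective hQ hR hP.1 hlim hnoise
      (LQSystem.measurable_staticFeedback (S.gainF γ P)))
  refine ⟨fun P' hP' => hP'.isSchurStable hQ hR hdet, P, hP, fun κ hκ => ?_, hval, fun hstab => ?_⟩
  · rw [hval]
    exact LQSystem.trace_le_softObjective hQ hR hP.1 hlim hnoise hκ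
  · obtain ⟨δ, hδ, hfb⟩ := hnoise.exists_feedback_perturbation (S := S) (S.gainF γ P)
      (S.gainE γ P) (S.gainDelta γ P)
    have hδval := le_antisymm (LQSystem.averagePayoff_gainF_le hQ hR hP.1 hnoise hδ)
      (LQSystem.trace_le_averagePayoff hQ hR hP.1 hnoise hstab hδ hfb)
    refine ⟨δ, hδ, hfb, fun δ' hδ' => ?_, hδval⟩
    rw [hδval]
    exact LQSystem.averagePayoff_gainF_le hQ hR hP.1 hnoise hδ'
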